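/- **Conventions.** A *propositional geometric theory* consists of atomic propositions and axioms $\varphi\Rightarrow\psi$, where $\varphi,\psi$ are built from atoms by finite conjunctions and arbitrary disjunctions. Its *locale* has as frame of opens the Lindenbaum algebra: formulas modulo provable equivalence, ordered by provable entailment. An *interpretation* of $S$ in $T$ assigns to each atom of $S$ a formula of $T$ so that the translated axioms of $S$ are derivable in $T$. Let $R$ be a Riesz space (vector lattice) over $\mathbb{Q}$ with a strong unit $1$ (for every $x\in R$ there is $n\in\mathbb{N}$ with $-n1\le x\le n1$); rationals $r$ are identified with $r1\in R$. * $\mathrm{Spec}(R)$ is the bounded distributive lattice generated by symbols $D(a)$, $a\in R$, subject to $D(1)=1$; $D(a)\wedge D(-a)=0$; $D(a+b)\le D(a)\vee D(b)$; $D(a)=0$ if $a\le 0$; $D(a\vee b)=D(a)\vee D(b)$. * $\mathrm{INT}$, the theory of integrals on $R$, has atoms $P(f)$ for $f\in R$ (read "$0<I(f)$") and axioms $P(1)=1$; $P(f)\wedge P(-f)=0$; $P(f+g)\le P(f)\vee P(g)$; $P(f)=0$ if $f\le 0$; $P(f)=\bigvee_{s\in\mathbb{Q},\,s>0}P(f-s)$.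 Here $p<I(f)$ stands for $P(f-p)$ and $I(f)<q$ for $P(q-f)$. * $\mathrm{VAL}$, the theory of valuations on the spectrum of $R$, has atoms "$p<\mu(x)$" for $p\in\mathbb{Q}$, $x\in\mathrm{Spec}(R)$, and axioms saying that each $\mu(x)$ is a nonnegative lower real; $\mu(0)=0$, $\mu(1)=1$; $\mu(x)+\mu(y)=\mu(x\vee y)+\mu(x\wedge y)$; $\mu(x)\le\mu(y)$ if $x\le y$ in $\mathrm{Spec}(R)$; and $\mu(D(a))\le\sup_{\varepsilon>0}\mu(D(a-\varepsilon))$. The relation $p<\mu(x)+\mu(y)$ stands for $\bigvee_{r+s=p}(r<\mu(x)\wedge s<\mu(y))$. For $f\in R$, $f\ge0$, and rationals $r<s$ put $\Delta_f(r,s)=\mu\big(D(f-r)\wedge D(s-f)\big)$ (a lower real) and $\Delta_f[r,s]=1-\big(\mu(D(r-f))+\mu(D(f-s))\big)$ (an upper real). **Theorem (Riesz representation theorem).** The theories $\mathrm{VAL}$ and $\mathrm{INT}$ are biinterpretable. Precisely, there are an interpretation of $\mathrm{VAL}$ in $\mathrm{INT}$ and an interpretation of $\mathrm{INT}$ in $\mathrm{VAL}$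 such that, up to provable equivalence: 1. for all $a\in R$, $p\in\mathbb{Q}$, the atom $p<\mu(D(a))$ is interpreted in $\mathrm{INT}$ as $p<\mu_I(D(a))$, where $\mu_I(D(a))=\sup_{n\in\mathbb{N}}I(n a^+\wedge 1)$; 2. for every $f\ge0$ in $R$ and every rational $b$ with $f\le c1$ for some rational $c<b$, the propositions $p<I(f)$ and $I(f)<q$ are interpreted in $\mathrm{VAL}$ as $p<I_\mu(f)$ and $I_\mu(f)<q$, where $$I_\mu(f)=\Big(\sup_{(s_i)}\sum_i s_i\,\Delta_f(s_i,s_{i+1}),\ \inf_{(s_i)}\sum_i s_{i+1}\,\Delta_f[s_i,s_{i+1}]\Big)$$ and $(s_i)$ ranges over the finite rational partitions $0=s_0<\dots<s_n=b$; for arbitrary $f\in R$, $P(f)$ is interpreted as $0<I_\mu(f^+)-I_\mu(f^-)$, that is, as $\bigvee_{q\in\mathbb{Q}}\big(I_\mu(f^-)<q\wedge q<I_\mu(f^+)\big)$ (with partitions of $[0,b]$ for $f^+$ and of $[0,b']$ for $f^-$, where $b,b'$ are any such bounds of $f^+$, $f^-$); 3. the two interpretations are mutually inverse: $I_{\mu_J}=J$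 and $\mu_{I_\nu}=\nu$, that is, translating an atom of either theory into the other theory and back gives a formula provably equivalent to that atom. Consequently the two interpretations induce mutually inverse homeomorphisms between the locale of valuations and the locale of integrals, and both locales are compact and completely regular. -/

import Mathlib

universe u

namespace RieszVal

/-! ### Propositional geometric logic -/

/-- Geometric (positive) propositional formulas over a type `G` of atomic propositions: they are
built with finite conjunctions and arbitrary (small) disjunctions. -/
inductive Formula (G : Type u) : Type (u + 1)
  | atom (g : G) : Formula G
  | top : Formula G
  | and (φ ψ : Formula G) : Formula G
  | disj (ι : Type u) (φ : ι → Formula G) : Formula G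

namespace Formula

variable {G H : Type u}

/-- Disjunction over an index type in the lowest universe (rationals, naturals, ...). -/
def any {ι : Type} (φ : ι → Formula G) : Formula G :=
  disj (ULift.{u} ι) fun i => φ i.down

/-- The false proposition: the empty disjunction. -/
def bot : Formula G := any fun i : Empty => i.elim

/-- Binary disjunction. -/
def or (φ ψ : Formula G) : Formula G := any fun b : Bool => if b then φ else ψ

/-- Conjunction of a finite list of formulas. -/
def conj : List (Formula G) → Formula G
  | [] => top
  | φ :: l => and φ (conj l)

/-- Conjunction of a finite family of formulas. -/
def all {n : ℕ} (φ : Fin n → Formula G) : Formula G := conj (List.ofFn φ)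

/-- Replacing every atom by a formula. -/
def subst (σ : G → Formula H) : Formula G → Formula H
  | atom g => σ g
  | top => top
  | and φ ψ => and (φ.subst σ) (ψ.subst σ)
  | disj ι φ => disj ι fun i => (φ i).subst σ

end Formula

/-- A propositional geometric theory: atomic propositions, and axioms `φ ⇒ ψ` between geometric
formulas. -/
structure Theory : Type (u + 2) where
  Atom : Type u
  Axiom : Formula Atom → Formula Atom → Prop

namespace Theory

open Formula

/-- Derivability of a sequent `φ ⇒ ψ` in (infinitary) geometric logic from the axioms of `T`. -/
inductive Entails (T : Theory.{u}) : Formula T.Atom → Formula T.Atom → Prop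
  | ax {φ ψ} : T.Axiom φ ψ → Entails T φ ψ
  | refl (φ) : Entails T φ φ
  | trans {φ ψ χ} : Entails T φ ψ → Entails T ψ χ → Entails T φ χ
  | le_top (φ) : Entails T φ top
  | and_left (φ ψ) : Entails T (and φ ψ) φ
  | and_right (φ ψ) : Entails T (and φ ψ) ψ
  | le_and {φ ψ χ} : Entails T φ ψ → Entails T φ χ → Entails T φ (and ψ χ)
  | le_disj {ι : Type u} (φ : ι → Formula T.Atom) (i : ι) : Entails T (φ i) (disj ι φ)
  | disj_le {ι : Type u} {φ : ι → Formula T.Atom} {ψ} :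
      (∀ i, Entails T (φ i) ψ) → Entails T (disj ι φ) ψ
  | distrib {ι : Type u} (φ) (ψ : ι → Formula T.Atom) :
      Entails T (and φ (disj ι ψ)) (disj ι fun i => and φ (ψ i))

/-- Provable equivalence in `T`. -/
def Equivalent (T : Theory.{u}) (φ ψ : Formula T.Atom) : Prop :=
  T.Entails φ ψ ∧ T.Entails ψ φ

variable (T : Theory.{u})

/-- The preorder of provable entailment. -/
@[reducible] def preorder : Preorder (Formula T.Atom) where
  le := T.Entails
  le_refl := Entails.refl
  le_trans _ _ _ := Entails.trans

/-- The (frame of opens of the) locale of a geometric theory: its Lindenbaum algebra, that is, the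
formulas modulo provable equivalence, ordered by provable entailment. -/
def Loc : Type (u + 1) :=
  letI := T.preorder
  Antisymmetrization (Formula T.Atom) (· ≤ ·)

/-- The open defined by a formula. -/
def opn (φ : Formula T.Atom) : T.Loc :=
  letI := T.preorder
  toAntisymmetrization (· ≤ ·) φ

instance : PartialOrder T.Loc :=
  @instPartialOrderAntisymmetrization (Formula T.Atom) T.preorder

theorem opn_le_opn {φ ψ : Formula T.Atom} : T.opn φ ≤ T.opn ψ ↔ T.Entails φ ψ := Iff.rfl

theorem opn_surjective : Function.Surjective T.opn := Quotient.mk_surjective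

/-- The conjunction of a list of atoms. -/
def basic (l : List T.Atom) : Formula T.Atom := conj (l.map atom)

variable {T} in
theorem Entails.and_mono {φ φ' ψ ψ' : Formula T.Atom} (h : T.Entails φ φ') (h' : T.Entails ψ ψ') :
    T.Entails (and φ ψ) (and φ' ψ') :=
  .le_and (.trans (.and_left _ _) h) (.trans (.and_right _ _) h')

theorem basic_append (l m : List T.Atom) :
    T.Entails (basic T (l ++ m)) (and (basic T l) (basic T m)) := by
  induction l with
  | nil => exact .le_and (.le_top _) (.refl _)
  | cons a l ih =>
    refine .le_and (.le_and (.and_left _ _) ?_) ?_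
    · exact (Entails.and_right _ _).trans (ih.trans (.and_left _ _))
    · exact (Entails.and_right _ _).trans (ih.trans (.and_right _ _))

theorem and_basic (l m : List T.Atom) :
    T.Entails (and (basic T l) (basic T m)) (basic T (l ++ m)) := by
  induction l with
  | nil => exact .and_right _ _
  | cons a l ih =>
    refine .le_and ((Entails.and_left _ _).trans (.and_left _ _)) (.trans ?_ ih)
    exact Entails.and_mono (.and_right _ _) (.refl _)

/-- Disjunctive normal form: every formula is the disjunction of the basic conjunctions below
it. -/
theorem normal_form (φ : Formula T.Atom) :
    T.Entails φ (disj {l : List T.Atom // T.Entails (basic T l) φ} fun l => basic T l.1) := by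
  induction φ with
  | atom g =>
    have h : T.Entails (basic T [g]) (atom g) := .and_left _ _
    have h' : T.Entails (atom g) (basic T [g]) := .le_and (.refl _) (.le_top _)
    exact h'.trans (.le_disj
      (fun l : {l : List T.Atom // T.Entails (basic T l) (atom g)} => basic T l.1) ⟨[g], h⟩)
  | top =>
    exact .le_disj (fun l : {l : List T.Atom // T.Entails (basic T l) top} => basic T l.1)
      ⟨[], .refl _⟩
  | and φ ψ ihφ ihψ =>
    refine (Entails.and_mono ihφ ihψ).trans ((Entails.distrib _ _).trans (.disj_le fun m => ?_))
    refine (Entails.le_and (.and_right _ _) (.and_left _ _)).trans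
      ((Entails.distrib _ _).trans (.disj_le fun l => ?_))
    refine (Entails.le_and (.and_right _ _) (.and_left _ _)).trans
      ((and_basic T l.1 m.1).trans ?_)
    exact .le_disj (fun k : {k : List T.Atom // T.Entails (basic T k) (and φ ψ)} => basic T k.1)
      ⟨l.1 ++ m.1, (basic_append T _ _).trans (Entails.and_mono l.2 m.2)⟩
  | disj ι φ ih =>
    refine .disj_le fun i => (ih i).trans (.disj_le fun l => ?_)
    exact .le_disj (fun k : {k : List T.Atom // T.Entails (basic T k) (disj ι φ)} => basic T k.1)
      ⟨l.1, l.2.trans (.le_disj φ i)⟩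

/-- The join of a set of opens: the disjunction of all basic conjunctions that lie below one of
them. -/
instance : SupSet T.Loc where
  sSup S := T.opn (disj {l : List T.Atom // ∃ x ∈ S, T.opn (basic T l) ≤ x} fun l => basic T l.1)

theorem isLUB_sSup (S : Set T.Loc) : IsLUB S (sSup S) := by
  constructor
  · intro x hx
    obtain ⟨φ, rfl⟩ := T.opn_surjective x
    refine (T.opn_le_opn).2 ((normal_form T φ).trans (.disj_le fun l => ?_))
    exact .le_disj (fun k : {k : List T.Atom // ∃ x ∈ S, T.opn (basic T k) ≤ x} => basic T k.1)
      ⟨l.1, _, hx, T.opn_le_opn.2 l.2⟩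
  · intro y hy
    obtain ⟨ψ, rfl⟩ := T.opn_surjective y
    refine (T.opn_le_opn).2 (.disj_le fun l => ?_)
    obtain ⟨x, hx, hl⟩ := l.2
    exact T.opn_le_opn.1 (hl.trans (hy hx))

instance : CompleteLattice T.Loc := completeLatticeOfSup T.Loc T.isLUB_sSup

theorem opn_inf_opn (φ ψ : Formula T.Atom) : T.opn φ ⊓ T.opn ψ = T.opn (and φ ψ) := by
  apply le_antisymm
  · obtain ⟨χ, hχ⟩ := T.opn_surjective (T.opn φ ⊓ T.opn ψ)
    have h1 : T.opn χ ≤ T.opn φ := hχ ▸ inf_le_left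
    have h2 : T.opn χ ≤ T.opn ψ := hχ ▸ inf_le_right
    rw [← hχ]
    exact Entails.le_and h1 h2
  · exact le_inf (Entails.and_left _ _ : T.Entails _ _) (Entails.and_right _ _ : T.Entails _ _)

instance : Order.Frame T.Loc := Order.Frame.ofMinimalAxioms
  { inf_sSup_le_iSup_inf := by
      intro a S
      obtain ⟨φ, rfl⟩ := T.opn_surjective a
      change T.opn φ ⊓ T.opn (disj _ _) ≤ _
      rw [opn_inf_opn]
      obtain ⟨ψ, hψ⟩ := T.opn_surjective (⨆ b ∈ S, T.opn φ ⊓ b)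
      rw [← hψ]
      refine (T.opn_le_opn).2 ((Entails.distrib _ _).trans (.disj_le fun l => T.opn_le_opn.1 ?_))
      obtain ⟨x, hx, hl⟩ := l.2
      rw [hψ, ← opn_inf_opn]
      exact (inf_le_inf_left _ hl).trans (le_iSup₂_of_le x hx le_rfl) }

end Theory

/-- An interpretation of the geometric theory `S` in the geometric theory `T`: a translation of
the atoms of `S` into formulas of `T` under which the axioms of `S` become derivable in `T`. -/
structure Interpretation (S T : Theory.{u}) where
  map : S.Atom → Formula T.Atom
  sound : ∀ φ ψ, S.Axiom φ ψ → T.Entails (φ.subst map) (ψ.subst map)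

/-- The translation of a formula under an interpretation. -/
def Interpretation.translate {S T : Theory.{u}} (Φ : Interpretation S T) (φ : Formula S.Atom) :
    Formula T.Atom :=
  φ.subst Φ.map

/-- Two interpretations are mutually inverse if translating an atom forth and back always gives a
proposition that is provably equivalent to the atom. -/
def Interpretation.MutuallyInverse {S T : Theory.{u}} (Φ : Interpretation S T)
    (Ψ : Interpretation T S) : Prop :=
  (∀ t : T.Atom, T.Equivalent (Φ.translate (Ψ.map t)) (.atom t)) ∧
    ∀ s : S.Atom, S.Equivalent (Ψ.translate (Φ.map s)) (.atom s)

/-! ### Compact completely regular locales -/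

section Locales

variable {F : Type*} [Order.Frame F]

/-- `x` is well inside (rather below) `y`. -/
def WellInside (x y : F) : Prop := xᶜ ⊔ y = ⊤

/-- `x` is completely below `y`: there is a scale from `x` to `y` indexed by the rationals in
`[0, 1]`, each member of which is well inside the later ones. -/
def CompletelyBelow (x y : F) : Prop :=
  ∃ c : ℚ → F, c 0 = x ∧ c 1 = y ∧ ∀ p q, 0 ≤ p → p < q → q ≤ 1 → WellInside (c p) (c q)

/-- The locale with frame of opens `F` is compact and completely regular. -/
def IsCompactCompletelyRegular (F : Type*) [Order.Frame F] : Prop :=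
  IsCompactElement (⊤ : F) ∧ ∀ y : F, y = sSup {x | CompletelyBelow x y}

end Locales

/-! ### The spectral lattice of a Riesz space -/

section Riesz

variable {R : Type u} [AddCommGroup R] [Lattice R]

/-- `e` is a strong unit: every element lies between `-n e` and `n e` for some natural `n`. -/
def IsStrongUnit (e : R) : Prop := ∀ x : R, ∃ n : ℕ, -(n • e) ≤ x ∧ x ≤ n • e

/-- Lattice terms in the generators `D a`. -/
inductive SpecTerm (R : Type u) : Type u
  | D (a : R) : SpecTerm R
  | top : SpecTerm R
  | bot : SpecTerm R
  | inf (x y : SpecTerm R) : SpecTerm R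
  | sup (x y : SpecTerm R) : SpecTerm R

/-- The least preorder on lattice terms that satisfies the laws of bounded distributive lattices
and the relations
`D e = 1`, `D a ∧ D (-a) = 0`, `D (a + b) ≤ D a ∨ D b`, `D a = 0` for `a ≤ 0`, and
`D (a ∨ b) = D a ∨ D b`. -/
inductive SpecLe (e : R) : SpecTerm R → SpecTerm R → Prop
  | refl (x) : SpecLe e x x
  | trans {x y z} : SpecLe e x y → SpecLe e y z → SpecLe e x z
  | le_top (x) : SpecLe e x .top
  | bot_le (x) : SpecLe e .bot x
  | inf_left (x y) : SpecLe e (.inf x y) x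
  | inf_right (x y) : SpecLe e (.inf x y) y
  | le_inf {x y z} : SpecLe e x y → SpecLe e x z → SpecLe e x (.inf y z)
  | sup_left (x y) : SpecLe e x (.sup x y)
  | sup_right (x y) : SpecLe e y (.sup x y)
  | sup_le {x y z} : SpecLe e x z → SpecLe e y z → SpecLe e (.sup x y) z
  | distrib (x y z) : SpecLe e (.inf x (.sup y z)) (.sup (.inf x y) (.inf x z))
  | rel_one : SpecLe e .top (.D e)
  | rel_neg (a) : SpecLe e (.inf (.D a) (.D (-a))) .bot
  | rel_add (a b) : SpecLe e (.D (a + b)) (.sup (.D a) (.D b))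
  | rel_nonpos (a) : a ≤ 0 → SpecLe e (.D a) .bot
  | rel_sup_le (a b) : SpecLe e (.D (a ⊔ b)) (.sup (.D a) (.D b))
  | rel_le_sup (a b) : SpecLe e (.sup (.D a) (.D b)) (.D (a ⊔ b))

/-- Entailment as a preorder on lattice terms. -/
@[reducible] def specPreorder (e : R) : Preorder (SpecTerm R) where
  le := SpecLe e
  le_refl := SpecLe.refl
  le_trans _ _ _ := SpecLe.trans

/-- The distributive lattice `Spec R` presented by the generators `D a` and the relations above. -/
def Spec (e : R) : Type u :=
  letI := specPreorder e
  Antisymmetrization (SpecTerm R) (· ≤ ·)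

namespace Spec

variable (e : R)

/-- The element of `Spec R` denoted by a lattice term. -/
def mk (x : SpecTerm R) : Spec e :=
  letI := specPreorder e
  toAntisymmetrization (· ≤ ·) x

/-- The generator `D a` of `Spec R`. -/
def D (a : R) : Spec e := mk e (.D a)

instance : PartialOrder (Spec e) :=
  @instPartialOrderAntisymmetrization (SpecTerm R) (specPreorder e)

instance : Lattice (Spec e) where
  inf := Quotient.map₂ SpecTerm.inf fun _ _ h _ _ h' =>
    ⟨.le_inf (.trans (.inf_left _ _) h.1) (.trans (.inf_right _ _) h'.1),
      .le_inf (.trans (.inf_left _ _) h.2) (.trans (.inf_right _ _) h'.2)⟩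
  sup := Quotient.map₂ SpecTerm.sup fun _ _ h _ _ h' =>
    ⟨.sup_le (.trans h.1 (.sup_left _ _)) (.trans h'.1 (.sup_right _ _)),
      .sup_le (.trans h.2 (.sup_left _ _)) (.trans h'.2 (.sup_right _ _))⟩
  inf_le_left := by rintro ⟨x⟩ ⟨y⟩; exact SpecLe.inf_left x y
  inf_le_right := by rintro ⟨x⟩ ⟨y⟩; exact SpecLe.inf_right x y
  le_inf := by rintro ⟨x⟩ ⟨y⟩ ⟨z⟩ h h'; exact SpecLe.le_inf h h'
  le_sup_left := by rintro ⟨x⟩ ⟨y⟩; exact SpecLe.sup_left x y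
  le_sup_right := by rintro ⟨x⟩ ⟨y⟩; exact SpecLe.sup_right x y
  sup_le := by rintro ⟨x⟩ ⟨y⟩ ⟨z⟩ h h'; exact SpecLe.sup_le h h'

instance : DistribLattice (Spec e) :=
  DistribLattice.ofInfSupLe (by rintro ⟨x⟩ ⟨y⟩ ⟨z⟩; exact SpecLe.distrib x y z)

instance : BoundedOrder (Spec e) where
  top := mk e .top
  bot := mk e .bot
  le_top := by rintro ⟨x⟩; exact SpecLe.le_top x
  bot_le := by rintro ⟨x⟩; exact SpecLe.bot_le x

end Spec

/-! ### The theories of integrals and of valuations -/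

variable [Module ℚ R] (e : R)

open Formula

/-- Axioms of the theory of integrals. The atom indexed by `f` is the proposition
`P f`, "`0 < I f`". -/
inductive IntAxiom : Formula R → Formula R → Prop
  | one : IntAxiom top (atom e)
  | neg (f : R) : IntAxiom (and (atom f) (atom (-f))) bot
  | add (f g : R) : IntAxiom (atom (f + g)) (or (atom f) (atom g))
  | nonpos (f : R) : f ≤ 0 → IntAxiom (atom f) bot
  | cont_le (f : R) :
      IntAxiom (atom f) (any fun s : {s : ℚ // 0 < s} => atom (f - s.1 • e))
  | cont_ge (f : R) :
      IntAxiom (any fun s : {s : ℚ // 0 < s} => atom (f - s.1 • e)) (atom f)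

/-- The geometric theory `INT` of (probability) integrals. -/
def INT : Theory.{u} where
  Atom := R
  Axiom := IntAxiom e

/-- The proposition `p < I f` of `INT`. -/
def intGt (f : R) (p : ℚ) : Formula (INT e).Atom := atom (G := R) (f - p • e)

/-- The proposition `I f < q` of `INT`. -/
def intLt (f : R) (q : ℚ) : Formula (INT e).Atom := atom (G := R) (q • e - f)

/-- The proposition `p < μ x`, where `μ x` is a lower real. -/
def valGt (x : Spec e) (p : ℚ) : Formula (ℚ × Spec e) := atom (p, x)

/-- The proposition `p < μ x + μ y` about the sum of two lower reals: `r < μ x` and `s < μ y` for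
some rationals with `r + s = p`. -/
def valAddGt (x y : Spec e) (p : ℚ) : Formula (ℚ × Spec e) :=
  any fun rs : {rs : ℚ × ℚ // rs.1 + rs.2 = p} => and (valGt e x rs.1.1) (valGt e y rs.1.2)

/-- Axioms of the theory of valuations. The atom `(p, x)` is the proposition `p < μ x`. -/
inductive ValAxiom : Formula (ℚ × Spec e) → Formula (ℚ × Spec e) → Prop
  /- `μ x` is a nonnegative lower real. -/
  | down (x : Spec e) (p q : ℚ) : p < q → ValAxiom (valGt e x q) (valGt e x p)
  | round (x : Spec e) (p : ℚ) :
      ValAxiom (valGt e x p) (any fun q : {q : ℚ // p < q} => valGt e x q.1)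
  | nonneg (x : Spec e) (p : ℚ) : p < 0 → ValAxiom top (valGt e x p)
  /- `μ 0 = 0` and `μ 1 = 1`. -/
  | bot_le (p : ℚ) : 0 ≤ p → ValAxiom (valGt e ⊥ p) bot
  | top_le (p : ℚ) : 1 ≤ p → ValAxiom (valGt e ⊤ p) bot
  | top_ge (p : ℚ) : p < 1 → ValAxiom top (valGt e ⊤ p)
  /- The modular law. -/
  | modular_le (x y : Spec e) (p : ℚ) :
      ValAxiom (valAddGt e x y p) (valAddGt e (x ⊔ y) (x ⊓ y) p)
  | modular_ge (x y : Spec e) (p : ℚ) :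
      ValAxiom (valAddGt e (x ⊔ y) (x ⊓ y) p) (valAddGt e x y p)
  /- Monotonicity. -/
  | mono (x y : Spec e) (p : ℚ) : x ≤ y → ValAxiom (valGt e x p) (valGt e y p)
  /- Scott continuity. -/
  | scott (a : R) (p : ℚ) :
      ValAxiom (valGt e (Spec.D e a) p)
        (any fun ε : {ε : ℚ // 0 < ε} => valGt e (Spec.D e (a - ε.1 • e)) p)

/-- The geometric theory `VAL` of (probability) valuations on `Spec R`. -/
def VAL : Theory.{u} where
  Atom := ℚ × Spec e
  Axiom := ValAxiom e

/-! ### From integrals to valuations -/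

/-- The proposition `p < sup_n I (n a⁺ ∧ 1)` of `INT`. -/
def supIntGt (a : R) (p : ℚ) : Formula (INT e).Atom :=
  any fun n : ℕ => intGt e ((n • a⁺) ⊓ e) p

/-! ### From valuations to integrals -/

/-- The open `(r < f)`. -/
def above (f : R) (r : ℚ) : Spec e := Spec.D e (f - r • e)

/-- The open `(f < s)`. -/
def below (f : R) (s : ℚ) : Spec e := Spec.D e (s • e - f)

/-- `f` is strictly below the constant `b` (uniformly on the spectrum). -/
def StrictlyBelow (f : R) (b : ℚ) : Prop := ∃ c : ℚ, c < b ∧ f ≤ c • e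

/-- A finite partition `0 = s_0 < s_1 < ... < s_n = b` by rationals. -/
structure RatPartition (b : ℚ) : Type where
  n : ℕ
  s : Fin (n + 1) → ℚ
  strictMono : StrictMono s
  first : s 0 = 0
  last : s (Fin.last n) = b

/-- The proposition `p < ∑ i, s_i Δ_f (s_i, s_{i+1})`, where `Δ_f (r, s) = μ (r < f < s)` is a
lower real. -/
def lowerSumGt (f : R) {b : ℚ} (P : RatPartition b) (p : ℚ) : Formula (VAL e).Atom :=
  any fun r : {r : Fin P.n → ℚ // p < ∑ i, P.s i.castSucc * r i} =>
    all fun i => valGt e (above e f (P.s i.castSucc) ⊓ below e f (P.s i.succ)) (r.1 i)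

/-- The proposition `Δ_f [r, s] < u`, where `Δ_f [r, s]` is the upper real
`1 - (μ (f < r) + μ (s < f))`. -/
def closedLt (f : R) (r s u : ℚ) : Formula (VAL e).Atom :=
  valAddGt e (below e f r) (above e f s) (1 - u)

/-- The proposition `∑ i, s_{i+1} Δ_f [s_i, s_{i+1}] < q`. -/
def upperSumLt (f : R) {b : ℚ} (P : RatPartition b) (q : ℚ) : Formula (VAL e).Atom :=
  any fun u : {u : Fin P.n → ℚ // ∑ i, P.s i.succ * u i < q} =>
    all fun i => closedLt e f (P.s i.castSucc) (P.s i.succ) (u.1 i)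

/-- For `f ≥ 0` strictly below `b`: the proposition `p < I_μ f`, that is,
`p < sup ∑ s_i Δ_f (s_i, s_{i+1})` over the partitions of `[0, b]`. -/
def stieltjesGt (f : R) (b p : ℚ) : Formula (VAL e).Atom :=
  any fun P : RatPartition b => lowerSumGt e f P p

/-- For `f ≥ 0` strictly below `b`: the proposition `I_μ f < q`, that is,
`inf ∑ s_{i+1} Δ_f [s_i, s_{i+1}] < q` over the partitions of `[0, b]`. -/
def stieltjesLt (f : R) (b q : ℚ) : Formula (VAL e).Atom :=
  any fun P : RatPartition b => upperSumLt e f P q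

/-- For arbitrary `f`, with `f⁺` strictly below `b` and `f⁻` strictly below `c`: the proposition
`0 < I_μ f` for `I_μ f = I_μ (f⁺) - I_μ (f⁻)`, that is, `I_μ (f⁻) < q < I_μ (f⁺)` for some `q`. -/
def stieltjesPos (f : R) (b c : ℚ) : Formula (VAL e).Atom :=
  any fun q : ℚ => and (stieltjesGt e f⁺ b q) (stieltjesLt e f⁻ c q)

end Riesz

end RieszVal

/-! Argued classically, both locales have enough points, so entailment can be tested on two-valued
models. The theorem then becomes the Riesz correspondence between numerical integrals and numerical
valuations.

Enough points. Compactness uses prime ideals: the opens outside a prime ideal satisfy the finitary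
axioms, and after rounding they yield a genuine model whose true atoms avoid the ideal
(`isCompactElement_top_of_models`). Complete regularity comes from explicit rational scales, such as
`I f > (1 - t) s`. In a compact completely regular locale a non-entailment is witnessed by a coatom,
and the opens not below a coatom form a model (`entails_of_forall_sat`).

Models. Those of `INT` are the normalized positive functionals (`exists_integral_of_isModel`), those
of `VAL` the continuous normalized valuations (`exists_valuation_of_isModel`). A functional `I`
gives `μ (D a) = sup_n I (n a⁺ ∧ e)`. This is well defined because `D a ≤ D b` forces `a⁺ ≤ q b⁺`
for some rational `q` (`Spec.posPart_le_smul_of_D_le`). Conversely, each valuation arises in this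
way: the functional is an ultrafilter limit of Riemann sums of `t ↦ μ (t < f)`
(`IsValuation.exists_integral`). Hence formulas of both theories can be tested on integrals alone
(`entails_INT`, `entails_VAL`).

Stieltjes sums. For `s < t`, the difference `I ((f - s)⁺) - I ((f - t)⁺)` lies between `(t - s) μ (t
< f)` and `(t - s) μ (s < f)`. Summation by parts then places `I f` between the lower and upper
sums, and partitions whose nonzero points carry little mass make both sums converge to `I f`
(`IsDistribution.exists_sums_near`). So the formula translating `P f` holds at the valuation of `I`
exactly when `0 < I f`. Soundness, the descriptions of the interpretations, and their being mutually
inverse all follow by evaluation at each `I`. -/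

set_option linter.unusedSectionVars false

namespace RieszVal

/-! ### Models -/

namespace Formula

variable {G H : Type u}

/-- Truth of a formula under an assignment of truth values to the atoms. -/
def Sat (v : G → Prop) : Formula G → Prop
  | atom g => v g
  | top => True
  | and φ ψ => Sat v φ ∧ Sat v ψ
  | disj _ φ => ∃ i, Sat v (φ i)

variable {v : G → Prop}

@[simp] theorem sat_atom {g : G} : Sat v (atom g) ↔ v g := Iff.rfl

@[simp] theorem sat_top : Sat v top := trivial

@[simp] theorem sat_and {φ ψ : Formula G} : Sat v (and φ ψ) ↔ Sat v φ ∧ Sat v ψ := Iff.rfl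

@[simp] theorem sat_disj {ι : Type u} {φ : ι → Formula G} :
    Sat v (disj ι φ) ↔ ∃ i, Sat v (φ i) := Iff.rfl

@[simp] theorem sat_any {ι : Type} {φ : ι → Formula G} :
    Sat v (any φ) ↔ ∃ i, Sat v (φ i) := by
  simp [any]

@[simp] theorem not_sat_bot : ¬ Sat v bot := by simp [bot]

@[simp] theorem sat_or {φ ψ : Formula G} : Sat v (or φ ψ) ↔ Sat v φ ∨ Sat v ψ := by
  simp [or, or_comm]

theorem sat_conj {l : List (Formula G)} : Sat v (conj l) ↔ ∀ φ ∈ l, Sat v φ := by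
  induction l with
  | nil => simp [conj]
  | cons φ l ih => simp [conj, ih]

@[simp] theorem sat_all {n : ℕ} {φ : Fin n → Formula G} :
    Sat v (all φ) ↔ ∀ i, Sat v (φ i) := by
  simp [all, sat_conj, List.mem_ofFn]

theorem sat_subst (σ : G → Formula H) (w : H → Prop) (φ : Formula G) :
    Sat w (φ.subst σ) ↔ Sat (fun g => Sat w (σ g)) φ := by
  induction φ with
  | atom g => rfl
  | top => rfl
  | and φ ψ h1 h2 => simp [subst, h1, h2]
  | disj ι φ ih => simp [subst, ih]

end Formula

namespace Theory

open Formula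

variable (T : Theory.{u})

/-- A (two-valued) model: an assignment of truth values under which all axioms hold. -/
def IsModel (v : T.Atom → Prop) : Prop := ∀ φ ψ, T.Axiom φ ψ → Sat v φ → Sat v ψ

variable {T}

theorem Entails.sat {φ ψ : Formula T.Atom} (h : T.Entails φ ψ) {v : T.Atom → Prop}
    (hv : T.IsModel v) : Sat v φ → Sat v ψ := by
  induction h with
  | ax h => exact hv _ _ h
  | refl => exact id
  | trans _ _ h1 h2 => exact h2 ∘ h1
  | le_top => exact fun _ => trivial
  | and_left => exact And.left
  | and_right => exact And.right
  | le_and _ _ h1 h2 => exact fun h => ⟨h1 h, h2 h⟩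
  | le_disj φ i => exact fun h => ⟨i, h⟩
  | disj_le _ ih => exact fun ⟨i, h⟩ => ih i h
  | distrib φ ψ => exact fun ⟨h, i, hi⟩ => ⟨i, h, hi⟩

theorem opn_top : T.opn top = ⊤ :=
  top_le_iff.1 (by obtain ⟨φ, hφ⟩ := T.opn_surjective ⊤; rw [← hφ]; exact Entails.le_top φ)

theorem opn_disj_le {ι : Type u} {φ : ι → Formula T.Atom} {x : T.Loc} :
    T.opn (disj ι φ) ≤ x ↔ ∀ i, T.opn (φ i) ≤ x := by
  obtain ⟨ψ, rfl⟩ := T.opn_surjective x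
  exact ⟨fun h i => (T.opn_le_opn.2 (.le_disj φ i)).trans h, fun h => Entails.disj_le h⟩

theorem opn_any_le {ι : Type} {φ : ι → Formula T.Atom} {x : T.Loc} :
    T.opn (any φ) ≤ x ↔ ∀ i, T.opn (φ i) ≤ x := by
  rw [any, opn_disj_le]
  exact ⟨fun h i => h ⟨i⟩, fun h i => h i.down⟩

theorem opn_bot : T.opn bot = ⊥ := le_bot_iff.1 (opn_any_le.2 fun i => i.elim)

theorem opn_le_opn_any {ι : Type} (φ : ι → Formula T.Atom) (i : ι) :
    T.opn (φ i) ≤ T.opn (any φ) := opn_any_le.1 le_rfl i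

theorem opn_or (φ ψ : Formula T.Atom) : T.opn (or φ ψ) = T.opn φ ⊔ T.opn ψ := by
  refine le_antisymm (opn_any_le.2 ?_) (sup_le ?_ ?_)
  · rintro (_ | _)
    · exact le_sup_right
    · exact le_sup_left
  · exact opn_le_opn_any (fun b : Bool => if b then φ else ψ) true
  · exact opn_le_opn_any (fun b : Bool => if b then φ else ψ) false

theorem opn_le_of_ax {φ ψ : Formula T.Atom} (h : T.Axiom φ ψ) : T.opn φ ≤ T.opn ψ := Entails.ax h

/-- The locale of `T` is compact as soon as for every prime ideal of opens there is a model, all of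
whose true atoms are outside the ideal. -/
theorem isCompactElement_top_of_models
    (H : ∀ Q : Order.Ideal T.Loc, Q.IsPrime →
      ∃ v : T.Atom → Prop, T.IsModel v ∧ ∀ g, v g → T.opn (atom g) ∉ Q) :
    IsCompactElement (⊤ : T.Loc) := by
  intro s u hs hd hu htop
  by_contra! hne
  obtain rfl : u = sSup s := hu.unique (T.isLUB_sSup s)
  let I : Order.Ideal T.Loc := Order.IsIdeal.toIdeal (I := {x | ∃ y ∈ s, x ≤ y})
    { IsLowerSet := fun a b hba ⟨y, hy, h⟩ => ⟨y, hy, hba.trans h⟩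
      Nonempty := hs.imp fun x hx => ⟨x, hx, le_rfl⟩
      Directed := by
        rintro a ⟨y, hy, hay⟩ b ⟨z, hz, hbz⟩
        obtain ⟨w, hw, hyw, hzw⟩ := hd y hy z hz
        exact ⟨w, ⟨w, hw, le_rfl⟩, hay.trans hyw, hbz.trans hzw⟩ }
  -- If no member of the directed family is the top, its down-closure is a proper ideal and extends
  -- to a prime one.
  have hdisj : Disjoint ((Order.PFilter.principal (⊤ : T.Loc)) : Set T.Loc) (I : Set T.Loc) := by
    rw [Set.disjoint_left]
    rintro x hx ⟨y, hy, hxy⟩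
    exact hne y hy (le_trans hx hxy)
  obtain ⟨Q, hQ, hIQ, -⟩ := DistribLattice.prime_ideal_of_disjoint_filter_ideal hdisj
  obtain ⟨v, hv, hvQ⟩ := H Q hQ
  have hQtop : (⊤ : T.Loc) ∉ Q := hQ.toIsProper.top_notMem
  have hbasic : ∀ l : List T.Atom, Sat v (basic T l) → T.opn (basic T l) ∉ Q := by
    intro l
    induction l with
    | nil => intro _; rw [show T.opn (basic T []) = ⊤ from opn_top]; exact hQtop
    | cons a l ih =>
      rintro ⟨ha, hl⟩ hmem
      rw [show T.opn (basic T (a :: l)) = T.opn (atom a) ⊓ T.opn (basic T l) from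
        (opn_inf_opn T _ _).symm] at hmem
      exact (hQ.mem_or_mem hmem).elim (hvQ a ha) (ih hl)
  rw [← opn_top] at htop
  -- The model satisfies some basic conjunction below a member of `s`. That conjunction lies in `I ≤
  -- Q`, yet it is a finite meet of opens outside the prime ideal `Q`.
  obtain ⟨⟨l, x, hx, hlx⟩, hl⟩ := Entails.sat (T.opn_le_opn.1 htop) hv trivial
  exact hbasic l hl (hIQ ⟨x, hx, hlx⟩)

end Theory

/-! ### Scales of well-inside opens; primality of coatoms -/

section Locales

variable {F : Type*} [Order.Frame F]

theorem WellInside.of_inf_of_sup {x y w : F} (h : x ⊓ w = ⊥) (h' : w ⊔ y = ⊤) :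
    WellInside x y := by
  refine top_le_iff.1 (h' ▸ sup_le_sup_right ?_ _)
  exact le_compl_iff_disjoint_left.2 (disjoint_iff.2 h)

theorem WellInside.le {x y : F} (h : WellInside x y) : x ≤ y := by
  have h1 : x ⊓ (xᶜ ⊔ y) = x := by rw [h, inf_top_eq]
  rw [inf_sup_left, inf_compl_self, bot_sup_eq] at h1
  exact h1 ▸ inf_le_right

theorem WellInside.mono_right {x y z : F} (h : WellInside x y) (hyz : y ≤ z) : WellInside x z :=
  top_le_iff.1 (h ▸ sup_le_sup_left hyz _)

theorem WellInside.inf {x y x' y' : F} (h : WellInside x y) (h' : WellInside x' y') :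
    WellInside (x ⊓ x') (y ⊓ y') := by
  unfold WellInside
  rw [sup_inf_left]
  exact inf_eq_top_iff.2
    ⟨top_le_iff.1 (h ▸ sup_le_sup_right (compl_le_compl inf_le_left) _),
      top_le_iff.1 (h' ▸ sup_le_sup_right (compl_le_compl inf_le_right) _)⟩

theorem CompletelyBelow.wellInside {x y : F} (h : CompletelyBelow x y) : WellInside x y := by
  obtain ⟨c, rfl, rfl, hc⟩ := h
  exact hc 0 1 le_rfl one_pos le_rfl

theorem CompletelyBelow.mono_right {x y z : F} (h : CompletelyBelow x y) (hyz : y ≤ z) :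
    CompletelyBelow x z := by
  obtain ⟨c, rfl, rfl, hc⟩ := h
  refine ⟨fun p => if p < 1 then c p else z, by simp, by simp, fun p q hp hpq hq => ?_⟩
  simp only [if_pos (hpq.trans_le hq)]
  split_ifs with h
  · exact hc p q hp hpq hq
  · obtain rfl : q = 1 := le_antisymm hq (not_lt.1 h)
    exact (hc p 1 hp hpq le_rfl).mono_right hyz

theorem CompletelyBelow.inf {x y x' y' : F} (h : CompletelyBelow x y)
    (h' : CompletelyBelow x' y') : CompletelyBelow (x ⊓ x') (y ⊓ y') := by
  obtain ⟨c, rfl, rfl, hc⟩ := h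
  obtain ⟨d, rfl, rfl, hd⟩ := h'
  exact ⟨fun p => c p ⊓ d p, rfl, rfl, fun p q h1 h2 h3 => (hc p q h1 h2 h3).inf (hd p q h1 h2 h3)⟩

theorem completelyBelow_top : CompletelyBelow (⊤ : F) ⊤ :=
  ⟨fun _ => ⊤, rfl, rfl, fun _ _ _ _ _ => by simp [WellInside]⟩

/-- Coatoms of a distributive lattice are prime. This is what makes "not below `m`" commute with
conjunction, hence a truth assignment. -/
theorem IsCoatom.le_or_le_of_inf_le {m a b : F} (hm : IsCoatom m) (h : a ⊓ b ≤ m) :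
    a ≤ m ∨ b ≤ m := by
  by_contra! hab
  have h1 : a ⊔ m = ⊤ := hm.2 _ (lt_of_le_of_ne le_sup_right fun h => hab.1 (h ▸ le_sup_left))
  have h2 : b ⊔ m = ⊤ := hm.2 _ (lt_of_le_of_ne le_sup_right fun h => hab.2 (h ▸ le_sup_left))
  apply hm.1
  rw [← sup_eq_right.2 h, sup_inf_right, h1, h2, inf_top_eq]

end Locales

/-! ### Regularity from atoms, and completeness for two-valued models -/

namespace Theory

open Formula

variable {T : Theory.{u}}

/-- Complete regularity only has to be checked on atoms, because the completely-below relation is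
stable under binary meets and under enlarging the right-hand side. -/
theorem eq_sSup_completelyBelow
    (H : ∀ g : T.Atom, T.opn (atom g) ≤ sSup {x | CompletelyBelow x (T.opn (atom g))})
    (y : T.Loc) : y = sSup {x | CompletelyBelow x y} := by
  refine le_antisymm ?_ (sSup_le fun x hx => hx.wellInside.le)
  obtain ⟨φ, rfl⟩ := T.opn_surjective y
  induction φ with
  | atom g => exact H g
  | top => rw [opn_top]; exact le_sSup completelyBelow_top
  | and φ ψ h1 h2 =>
    rw [← opn_inf_opn]
    refine (inf_le_inf h1 h2).trans ?_
    rw [sSup_inf_sSup]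
    refine iSup₂_le fun p hp => le_sSup ?_
    exact CompletelyBelow.inf hp.1 hp.2
  | disj ι φ ih =>
    refine opn_disj_le.2 fun i => (ih i).trans (sSup_le_sSup fun x hx => ?_)
    exact CompletelyBelow.mono_right hx (T.opn_le_opn.2 (.le_disj φ i))

/-- A theory with a compact completely regular locale is complete for two-valued models. -/
theorem entails_of_forall_sat (hT : IsCompactCompletelyRegular T.Loc) {φ ψ : Formula T.Atom}
    (h : ∀ v, T.IsModel v → Sat v φ → Sat v ψ) : T.Entails φ ψ := by
  by_contra hne
  -- Shrinking `φ` to a `z` well inside it keeps the failure `¬ z ≤ ψ` and ensures `zᶜ ⊔ φ = ⊤`. A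
  -- coatom above `zᶜ ⊔ ψ` therefore cannot contain `φ`.
  obtain ⟨z, hz, hzψ⟩ : ∃ z, CompletelyBelow z (T.opn φ) ∧ ¬ z ≤ T.opn ψ := by
    by_contra! hz
    apply hne
    rw [← T.opn_le_opn, hT.2 (T.opn φ)]
    exact sSup_le hz
  have : IsCoatomic T.Loc := CompleteLattice.coatomic_of_top_compact hT.1
  have hproper : zᶜ ⊔ T.opn ψ ≠ ⊤ := fun hz' => hzψ (WellInside.le hz')
  obtain ⟨m, hm, hle⟩ := (eq_top_or_exists_le_coatom (zᶜ ⊔ T.opn ψ)).resolve_left hproper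
  have hsat : ∀ χ : Formula T.Atom, Sat (fun g => ¬ T.opn (atom g) ≤ m) χ ↔ ¬ T.opn χ ≤ m := by
    intro χ
    induction χ with
    | atom g => rfl
    | top => simpa [opn_top] using hm.1
    | and φ ψ h1 h2 =>
      rw [sat_and, h1, h2, ← opn_inf_opn, ← not_or, not_iff_not]
      exact ⟨fun h => h.elim inf_le_left.trans inf_le_right.trans, IsCoatom.le_or_le_of_inf_le hm⟩
    | disj ι φ ih => simp [ih, opn_disj_le]
  have hmodel : T.IsModel fun g => ¬ T.opn (atom g) ≤ m := fun α β hαβ hα =>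
    (hsat β).2 fun hβ => (hsat α).1 hα ((opn_le_of_ax hαβ).trans hβ)
  refine (hsat ψ).1 (h _ hmodel ((hsat φ).2 fun hφ => hm.1 ?_)) (le_sup_right.trans hle)
  exact top_le_iff.1 (hz.wellInside ▸ sup_le (le_sup_left.trans hle) hφ)

end Theory

/-! ### Interpretations -/

namespace Interpretation

open Formula

variable {S T : Theory.{u}}

theorem translate_entails (Φ : Interpretation S T) {φ ψ : Formula S.Atom} (h : S.Entails φ ψ) :
    T.Entails (Φ.translate φ) (Φ.translate ψ) := by
  induction h with
  | ax h => exact Φ.sound _ _ h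
  | refl => exact .refl _
  | trans _ _ h1 h2 => exact h1.trans h2
  | le_top => exact .le_top _
  | and_left => exact .and_left _ _
  | and_right => exact .and_right _ _
  | le_and _ _ h1 h2 => exact .le_and h1 h2
  | le_disj φ i => exact .le_disj (fun i => Φ.translate (φ i)) i
  | disj_le _ ih => exact .disj_le ih
  | distrib φ ψ => exact .distrib _ _

theorem translate_translate (Φ : Interpretation S T) (Ψ : Interpretation T S)
    (h : ∀ t : T.Atom, T.Equivalent (Φ.translate (Ψ.map t)) (.atom t)) (φ : Formula T.Atom) :
    T.Equivalent (Φ.translate (Ψ.translate φ)) φ := by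
  induction φ with
  | atom t => exact h t
  | top => exact ⟨.refl _, .refl _⟩
  | and φ ψ h1 h2 => exact ⟨h1.1.and_mono h2.1, h1.2.and_mono h2.2⟩
  | disj ι φ ih =>
    exact ⟨.disj_le fun i => (ih i).1.trans (.le_disj φ i),
      .disj_le fun i => (ih i).2.trans
        (.le_disj (fun i => Φ.translate (Ψ.translate (φ i))) i)⟩

/-- The monotone map on opens induced by an interpretation. -/
def locMap (Φ : Interpretation S T) : S.Loc → T.Loc :=
  Quotient.map Φ.translate fun _ _ h => ⟨Φ.translate_entails h.1, Φ.translate_entails h.2⟩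

theorem locMap_mono (Φ : Interpretation S T) : Monotone Φ.locMap := by
  intro x y h
  obtain ⟨φ, rfl⟩ := S.opn_surjective x
  obtain ⟨ψ, rfl⟩ := S.opn_surjective y
  exact Φ.translate_entails h

theorem locMap_locMap (Φ : Interpretation S T) (Ψ : Interpretation T S)
    (h : ∀ t : T.Atom, T.Equivalent (Φ.translate (Ψ.map t)) (.atom t)) (x : T.Loc) :
    Φ.locMap (Ψ.locMap x) = x := by
  obtain ⟨φ, rfl⟩ := T.opn_surjective x
  have := Φ.translate_translate Ψ h φ
  exact le_antisymm this.1 this.2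

/-- Mutually inverse interpretations induce an isomorphism of frames of opens. -/
def MutuallyInverse.locIso {Φ : Interpretation S T} {Ψ : Interpretation T S}
    (h : Φ.MutuallyInverse Ψ) : S.Loc ≃o T.Loc :=
  Equiv.toOrderIso ⟨Φ.locMap, Ψ.locMap, Ψ.locMap_locMap Φ h.2, Φ.locMap_locMap Ψ h.1⟩
    Φ.locMap_mono Ψ.locMap_mono

end Interpretation

/-! ### Riesz spaces with a strong unit -/

section RieszSpace

variable {R : Type u} [AddCommGroup R] [Lattice R] [IsOrderedAddMonoid R] [Module ℚ R]
  [IsOrderedModule ℚ R] {e : R}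

theorem smul_sup_of_pos {q : ℚ} (hq : 0 < q) (a b : R) : q • (a ⊔ b) = q • a ⊔ q • b :=
  (OrderIso.smulRight (β := R) hq).map_sup a b

theorem smul_inf_of_pos {q : ℚ} (hq : 0 < q) (a b : R) : q • (a ⊓ b) = q • a ⊓ q • b :=
  (OrderIso.smulRight (β := R) hq).map_inf a b

theorem smul_posPart {q : ℚ} (hq : 0 < q) (a : R) : (q • a)⁺ = q • a⁺ := by
  rw [posPart_def, posPart_def, smul_sup_of_pos hq, smul_zero]

theorem inf_sup_distrib (a b c : R) : a ⊓ (b ⊔ c) = (a ⊓ b) ⊔ (a ⊓ c) :=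
  letI := AddCommGroup.toDistribLattice R
  inf_sup_left a b c

/-- From `-(n e) ≤ e` one gets `0 ≤ (n + 1) e`, and rational scalars allow division by `n + 1`. -/
theorem IsStrongUnit.nonneg (he : IsStrongUnit e) : 0 ≤ e := by
  obtain ⟨n, hn, -⟩ := he e
  have h : 0 ≤ ((n + 1 : ℕ) : ℚ) • e := by
    rw [Nat.cast_smul_eq_nsmul, succ_nsmul]
    simpa [neg_le_iff_add_nonneg, add_comm] using hn
  have := smul_nonneg (a := (((n + 1 : ℕ) : ℚ))⁻¹) (by positivity) h
  rwa [smul_smul, inv_mul_cancel₀ (by positivity), one_smul] at this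

theorem IsStrongUnit.exists_le_smul (he : IsStrongUnit e) (a : R) :
    ∃ q : ℚ, 0 < q ∧ a ≤ q • e := by
  obtain ⟨n, -, hn⟩ := he a
  refine ⟨(n + 1 : ℕ), by positivity, hn.trans ?_⟩
  rw [Nat.cast_smul_eq_nsmul]
  exact nsmul_le_nsmul_left he.nonneg n.le_succ

theorem IsStrongUnit.exists_strictlyBelow (he : IsStrongUnit e) (a : R) :
    ∃ b : ℚ, StrictlyBelow e a b := by
  obtain ⟨q, -, hq⟩ := he.exists_le_smul a
  exact ⟨q + 1, q, lt_add_one q, hq⟩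

theorem posPart_add_le (a b : R) : (a + b)⁺ ≤ a⁺ + b⁺ :=
  sup_le (add_le_add (le_posPart a) (le_posPart b)) (add_nonneg (posPart_nonneg a) (posPart_nonneg b))

theorem IsStrongUnit.smul_le_smul (he : IsStrongUnit e) {p q : ℚ} (h : p ≤ q) : p • e ≤ q • e :=
  smul_le_smul_of_nonneg_right h he.nonneg

end RieszSpace

/-! ### The spectral lattice -/

namespace Spec

variable {R : Type u} [AddCommGroup R] [Lattice R] [IsOrderedAddMonoid R] {e : R}

theorem D_self : D e e = ⊤ := top_le_iff.1 SpecLe.rel_one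

theorem D_inf_D_neg (a : R) : D e a ⊓ D e (-a) = ⊥ := le_bot_iff.1 (SpecLe.rel_neg a)

theorem D_add_le (a b : R) : D e (a + b) ≤ D e a ⊔ D e b := SpecLe.rel_add a b

theorem D_of_nonpos {a : R} (h : a ≤ 0) : D e a = ⊥ := le_bot_iff.1 (SpecLe.rel_nonpos a h)

theorem D_sup (a b : R) : D e (a ⊔ b) = D e a ⊔ D e b :=
  le_antisymm (SpecLe.rel_sup_le a b) (SpecLe.rel_le_sup a b)

theorem D_mono {a b : R} (h : a ≤ b) : D e a ≤ D e b := by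
  rw [← sup_eq_right.2 h, D_sup]; exact le_sup_left

theorem D_posPart (a : R) : D e a⁺ = D e a := by
  rw [posPart_def, D_sup, D_of_nonpos le_rfl, sup_bot_eq]

/-- Since `a = a ∧ b + (a - b)⁺`, the open `D a` is covered by `D (a ∧ b)` and `D (a - b)`, and
symmetrically for `b`. The two remainders are disjoint. -/
theorem D_inf (a b : R) : D e (a ⊓ b) = D e a ⊓ D e b := by
  refine le_antisymm (le_inf (D_mono inf_le_left) (D_mono inf_le_right)) ?_
  have h1 : D e a ≤ D e (a ⊓ b) ⊔ D e (a - b) := by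
    have := D_add_le (e := e) (a ⊓ b) (a - b)⁺
    rwa [D_posPart, inf_eq_sub_posPart_sub, sub_add_cancel, ← inf_eq_sub_posPart_sub] at this
  have h2 : D e b ≤ D e (a ⊓ b) ⊔ D e (-(a - b)) := by
    have := D_add_le (e := e) (b ⊓ a) (b - a)⁺
    rwa [D_posPart, inf_eq_sub_posPart_sub, sub_add_cancel, ← inf_eq_sub_posPart_sub, inf_comm,
      ← neg_sub] at this
  refine (inf_le_inf h1 h2).trans ?_
  rw [← sup_inf_left, D_inf_D_neg, sup_bot_eq]

theorem D_nsmul_le (n : ℕ) (a : R) : D e (n • a) ≤ D e a := by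
  induction n with
  | zero => rw [zero_smul, D_of_nonpos le_rfl]; exact bot_le
  | succ n ih => rw [succ_nsmul]; exact (D_add_le _ _).trans (sup_le ih le_rfl)

/-- The generators are closed under finite meets and joins, so a valuation can be described by its
values on elements of `R`. -/
theorem exists_D_eq (x : Spec e) : ∃ a, D e a = x := by
  obtain ⟨t, rfl⟩ : ∃ t, mk e t = x := Quotient.exists_rep x
  induction t with
  | D a => exact ⟨a, rfl⟩
  | top => exact ⟨e, D_self⟩
  | bot => exact ⟨0, D_of_nonpos le_rfl⟩
  | inf x y hx hy =>
    obtain ⟨a, ha⟩ := hx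
    obtain ⟨b, hb⟩ := hy
    exact ⟨a ⊓ b, by rw [D_inf, ha, hb]; rfl⟩
  | sup x y hx hy =>
    obtain ⟨a, ha⟩ := hx
    obtain ⟨b, hb⟩ := hy
    exact ⟨a ⊔ b, by rw [D_sup, ha, hb]; rfl⟩

variable [Module ℚ R] [IsOrderedModule ℚ R]

theorem D_smul_le (q : ℚ) (hq : 0 < q) (a : R) : D e (q • a) ≤ D e a := by
  obtain ⟨n, hn⟩ := exists_nat_ge q
  rw [← D_posPart a, ← D_posPart (q • a), smul_posPart hq]
  refine le_trans (D_mono ?_) (D_nsmul_le n a⁺)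
  rw [← Nat.cast_smul_eq_nsmul ℚ]
  exact smul_le_smul_of_nonneg_right hn (posPart_nonneg a)

theorem D_smul {q : ℚ} (hq : 0 < q) (a : R) : D e (q • a) = D e a := by
  refine le_antisymm (D_smul_le q hq a) ?_
  conv_lhs => rw [← one_smul ℚ a, ← inv_mul_cancel₀ hq.ne', ← smul_smul]
  exact D_smul_le _ (inv_pos.2 hq) _

theorem D_smul_unit {q : ℚ} (hq : 0 < q) : D e (q • e) = ⊤ := by rw [D_smul hq, D_self]

/-- The positive element denoted by a lattice term. -/
def norm (e : R) : SpecTerm R → R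
  | .D a => a⁺
  | .top => e
  | .bot => 0
  | .inf x y => norm e x ⊓ norm e y
  | .sup x y => norm e x ⊔ norm e y

theorem norm_nonneg (he : IsStrongUnit e) (x : SpecTerm R) : 0 ≤ norm e x := by
  induction x with
  | D a => exact posPart_nonneg a
  | top => exact he.nonneg
  | bot => exact le_rfl
  | inf x y hx hy => exact le_inf hx hy
  | sup x y hx hy => exact hx.trans le_sup_left

/-- Induction on derivations: domination up to a positive rational factor satisfies every rule
defining `SpecLe`. The factor is genuinely needed for `D e = 1` (strong unit) and for `rel_add`
(factor 2). This extracts an inequality in `R` from one in the spectrum. -/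
theorem norm_le_smul_norm (he : IsStrongUnit e) {x y : SpecTerm R} (h : SpecLe e x y) :
    ∃ q : ℚ, 0 < q ∧ norm e x ≤ q • norm e y := by
  have key : ∀ {x y : SpecTerm R}, norm e x ≤ norm e y → ∃ q : ℚ, 0 < q ∧ norm e x ≤ q • norm e y :=
    fun h => ⟨1, one_pos, by rwa [one_smul]⟩
  have bump : ∀ {p q : ℚ} (y : SpecTerm R), p ≤ q → p • norm e y ≤ q • norm e y := fun y h =>
    smul_le_smul_of_nonneg_right h (norm_nonneg he y)
  induction h with
  | refl x => exact key le_rfl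
  | @trans x y z _ _ h1 h2 =>
    obtain ⟨p, hp, h1⟩ := h1
    obtain ⟨q, hq, h2⟩ := h2
    refine ⟨p * q, mul_pos hp hq, h1.trans ?_⟩
    rw [← smul_smul]
    exact smul_le_smul_of_nonneg_left h2 hp.le
  | le_top x => exact he.exists_le_smul _
  | bot_le x => exact key (norm_nonneg he x)
  | inf_left x y => exact key inf_le_left
  | inf_right x y => exact key inf_le_right
  | @le_inf x y z _ _ h1 h2 =>
    obtain ⟨p, hp, h1⟩ := h1
    obtain ⟨q, hq, h2⟩ := h2
    refine ⟨max p q, lt_max_of_lt_left hp, ?_⟩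
    rw [norm, smul_inf_of_pos (lt_max_of_lt_left hp)]
    exact le_inf (h1.trans (bump y (le_max_left _ _))) (h2.trans (bump z (le_max_right _ _)))
  | sup_left x y => exact key le_sup_left
  | sup_right x y => exact key le_sup_right
  | @sup_le x y z _ _ h1 h2 =>
    obtain ⟨p, hp, h1⟩ := h1
    obtain ⟨q, hq, h2⟩ := h2
    exact ⟨max p q, lt_max_of_lt_left hp, _root_.sup_le (h1.trans (bump z (le_max_left _ _)))
      (h2.trans (bump z (le_max_right _ _)))⟩
  | distrib x y z => exact key (inf_sup_distrib _ _ _).le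
  | rel_one => exact key (le_posPart e)
  | rel_neg a => exact key (by rw [norm, norm, norm, norm, posPart_neg, posPart_inf_negPart_eq_zero])
  | rel_add a b =>
    refine ⟨2, two_pos, (posPart_add_le a b).trans ?_⟩
    rw [two_smul]
    exact add_le_add le_sup_left le_sup_right
  | rel_nonpos a h => exact key (posPart_eq_zero.2 h).le
  | rel_sup_le a b =>
    exact key (_root_.sup_le (_root_.sup_le ((le_posPart a).trans le_sup_left)
      ((le_posPart b).trans le_sup_right)) ((posPart_nonneg a).trans le_sup_left))
  | rel_le_sup a b =>
    exact key (_root_.sup_le (posPart_mono le_sup_left) (posPart_mono le_sup_right))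

theorem posPart_le_smul_of_D_le (he : IsStrongUnit e) {a b : R} (h : D e a ≤ D e b) :
    ∃ q : ℚ, 0 < q ∧ a⁺ ≤ q • b⁺ :=
  norm_le_smul_norm he h

/-- From `a⁺ ≤ q b⁺`, wherever `a` exceeds `ε`, `b` exceeds `ε / q`. This makes the continuous part
of a valuation depend only on `D a`. -/
theorem exists_D_sub_le_D_sub (he : IsStrongUnit e) {a b : R} (h : D e a ≤ D e b) {ε : ℚ}
    (hε : 0 < ε) : ∃ δ : ℚ, 0 < δ ∧ D e (a - ε • e) ≤ D e (b - δ • e) := by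
  obtain ⟨q, hq, hab⟩ := posPart_le_smul_of_D_le he h
  refine ⟨ε / q, div_pos hε hq, ?_⟩
  have h1 : a - ε • e ≤ q • (b⁺ - (ε / q) • e) := by
    rw [smul_sub, smul_smul, mul_div_cancel₀ _ hq.ne']
    exact sub_le_sub_right ((le_posPart a).trans hab) _
  refine (D_mono h1).trans ?_
  rw [D_smul hq, posPart_def, sup_sub, D_sup, zero_sub]
  refine sup_le le_rfl ?_
  rw [D_of_nonpos (neg_nonpos.2 (smul_nonneg (div_pos hε hq).le he.nonneg))]
  exact bot_le

theorem D_sub_smul_anti (he : IsStrongUnit e) (a : R) {p q : ℚ} (h : p ≤ q) :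
    D e (a - q • e) ≤ D e (a - p • e) :=
  D_mono (sub_le_sub_left (he.smul_le_smul h) _)

theorem D_sub_unit_inf (he : IsStrongUnit e) (a : R) {p q : ℚ} (h : q ≤ p) :
    D e (a - p • e) ⊓ D e (q • e - a) = ⊥ := by
  rw [← le_bot_iff, ← D_inf_D_neg (e := e) (a - p • e), neg_sub]
  exact inf_le_inf_left _ (D_mono (sub_le_sub_right (he.smul_le_smul h) _))

theorem D_sub_unit_sup (a : R) {p q : ℚ} (h : p < q) :
    D e (a - p • e) ⊔ D e (q • e - a) = ⊤ := by
  rw [← top_le_iff, ← D_smul_unit (sub_pos.2 h)]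
  refine le_trans (le_of_eq ?_) (D_add_le _ _)
  rw [sub_smul]; congr 1; abel

end Spec

open Formula Theory Filter Topology

theorem exists_rat_lt_add {a b c : ℝ} (h : c < a + b) :
    ∃ p q : ℚ, (p : ℝ) < a ∧ (q : ℝ) < b ∧ c < p + q := by
  obtain ⟨p, hp, hpa⟩ := exists_rat_btwn (show c - b < a by linarith)
  obtain ⟨q, hq, hqb⟩ := exists_rat_btwn (show c - p < b by linarith)
  exact ⟨p, q, hpa, hqb, by linarith⟩

theorem exists_rat_add_lt {a b c : ℝ} (h : a + b < c) :
    ∃ p q : ℚ, a < p ∧ b < q ∧ (p : ℝ) + q < c := by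
  obtain ⟨p, hp, hpa⟩ := exists_rat_btwn (show a < c - b by linarith)
  obtain ⟨q, hq, hqb⟩ := exists_rat_btwn (show b < c - p by linarith)
  exact ⟨p, q, hp, hq, by linarith⟩

variable {R : Type u} [AddCommGroup R] [Lattice R] [IsOrderedAddMonoid R] [Module ℚ R]
  [IsOrderedModule ℚ R] {e : R}

/-! ### Integrals -/

/-- Normalized positive linear functionals. -/
structure IsIntegral (e : R) (I : R →+ ℝ) : Prop where
  nonneg : ∀ f, 0 ≤ f → 0 ≤ I f
  unit : I e = 1

namespace IsIntegral

variable {I : R →+ ℝ} (hI : IsIntegral e I)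

include hI

theorem mono {f g : R} (h : f ≤ g) : I f ≤ I g := by
  have := hI.nonneg (g - f) (sub_nonneg.2 h)
  rw [map_sub] at this
  linarith

theorem smul_unit (q : ℚ) : I (q • e) = q := by
  rw [map_rat_smul, hI.unit, Rat.smul_def, mul_one]

theorem map_sub_smul_unit (f : R) (q : ℚ) : I (f - q • e) = I f - q := by
  rw [map_sub, hI.smul_unit]

/-- An integral defines a model. -/
theorem isModel : (INT e).IsModel fun f : R => 0 < I f := by
  rintro φ ψ (_ | f | ⟨f, g⟩ | ⟨f, hf⟩ | f | f) h
  · exact (by rw [hI.unit]; exact one_pos : 0 < I e)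
  · obtain ⟨h1, h2⟩ : 0 < I f ∧ 0 < I (-f) := h
    rw [map_neg] at h2
    linarith
  · replace h : 0 < I (f + g) := h
    rw [map_add] at h
    refine sat_or.2 (show 0 < I f ∨ 0 < I g from ?_)
    by_contra! hc
    linarith
  · have h1 := (show 0 < I f from h).trans_le (hI.mono hf)
    rw [map_zero] at h1
    exact absurd h1 (lt_irrefl _)
  · obtain ⟨q, hq, hqf⟩ := exists_rat_btwn (show 0 < I f from h)
    refine sat_any.2 ⟨⟨q, by exact_mod_cast hq⟩, (?_ : 0 < I (f - q • e))⟩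
    rw [hI.map_sub_smul_unit]
    linarith
  · obtain ⟨⟨q, hq⟩, h⟩ := sat_any.1 h
    replace h : 0 < I (f - q • e) := h
    have : (0 : ℝ) < q := by exact_mod_cast hq
    rw [hI.map_sub_smul_unit] at h
    exact (by linarith : 0 < I f)

end IsIntegral

/-- The finitary part of the theory of integrals. -/
structure IsPreIntegral (e : R) (v : R → Prop) : Prop where
  one : v e
  neg : ∀ f, v f → v (-f) → False
  add : ∀ f g, v (f + g) → v f ∨ v g
  nonpos : ∀ f, f ≤ 0 → ¬ v f

namespace IsPreIntegral

variable {v : R → Prop} (hv : IsPreIntegral e v)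

include hv

theorem mono {f g : R} (h : f ≤ g) (hf : v f) : v g := by
  rw [← add_sub_cancel g f] at hf
  exact (hv.add _ _ hf).resolve_right (hv.nonpos _ (sub_nonpos.2 h))

theorem smul_unit {q : ℚ} (hq : 0 < q) (he : IsStrongUnit e) : v (q • e) := by
  obtain ⟨n, hn⟩ := exists_nat_ge (q⁻¹)
  have key : ∀ n : ℕ, v (n • (q • e)) → v (q • e) := by
    intro n
    induction n with
    | zero => intro h; exact absurd h (hv.nonpos _ (by simp))
    | succ n ih =>
      intro h
      rw [succ_nsmul] at h
      exact (hv.add _ _ h).elim ih id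
  refine key n (hv.mono ?_ hv.one)
  rw [← Nat.cast_smul_eq_nsmul ℚ, smul_smul]
  nth_rw 1 [← one_smul ℚ e]
  exact he.smul_le_smul ((inv_le_iff_one_le_mul₀ hq).1 hn)

/-- Rounding turns a model of the finitary part into a model. -/
theorem isModel_round (he : IsStrongUnit e) :
    (INT e).IsModel fun f : R => ∃ s : ℚ, 0 < s ∧ v (f - s • e) := by
  rintro φ ψ (_ | f | ⟨f, g⟩ | ⟨f, hf⟩ | f | f)
  · intro _
    refine ⟨1 / 2, by norm_num, ?_⟩
    nth_rw 1 [← one_smul ℚ e]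
    rw [← sub_smul]
    exact hv.smul_unit (by norm_num) he
  · rintro ⟨⟨s, hs, h1⟩, ⟨t, ht, h2⟩⟩
    refine (hv.neg _ h1 (hv.mono ?_ h2)).elim
    rw [neg_sub, ← neg_add_eq_sub, add_comm, sub_eq_add_neg, add_comm, ← neg_smul]
    exact add_le_add_left (he.smul_le_smul (by linarith)) _
  · rintro ⟨s, hs, h⟩
    have h' : f + g - s • e = (f - (s / 2) • e) + (g - (s / 2) • e) := by
      rw [← add_sub_add_comm, ← add_smul, add_halves]
    rw [h'] at h
    exact sat_or.2 ((hv.add _ _ h).imp (fun h => ⟨s / 2, by linarith, h⟩)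
      fun h => ⟨s / 2, by linarith, h⟩)
  · rintro ⟨s, hs, h⟩
    exact (hv.nonpos _ ((sub_le_self _ (smul_nonneg hs.le he.nonneg)).trans hf) h).elim
  · rintro ⟨s, hs, h⟩
    refine sat_any.2 ⟨⟨s / 2, by linarith⟩, s / 2, by linarith, ?_⟩
    rwa [sub_sub, ← add_smul, add_halves]
  · intro h
    obtain ⟨⟨t, ht⟩, s, hs, h⟩ := sat_any.1 h
    exact ⟨s, hs, hv.mono (sub_le_sub_right (sub_le_self _ (smul_nonneg ht.le he.nonneg)) _) h⟩

end IsPreIntegral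

theorem isPreIntegral_of_isModel {v : R → Prop} (hv : (INT e).IsModel v) : IsPreIntegral e v where
  one := hv _ _ IntAxiom.one trivial
  neg f h1 h2 := not_sat_bot (hv _ _ (IntAxiom.neg f) ⟨h1, h2⟩)
  add f g h := sat_or.1 (hv _ _ (IntAxiom.add f g) h)
  nonpos f hf h := not_sat_bot (hv _ _ (IntAxiom.nonpos f hf) h)

/-- Every model of the theory of integrals comes from an integral. -/
theorem exists_integral_of_isModel (he : IsStrongUnit e) {v : R → Prop}
    (hv : (INT e).IsModel v) :
    ∃ I : R →+ ℝ, IsIntegral e I ∧ ∀ f, v f ↔ 0 < I f := by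
  have hp := isPreIntegral_of_isModel hv
  have hround : ∀ f, v f → ∃ s : ℚ, 0 < s ∧ v (f - s • e) := fun f hf => by
    obtain ⟨⟨s, hs⟩, h⟩ := sat_any.1 (hv _ _ (IntAxiom.cont_le f) hf)
    exact ⟨s, hs, h⟩
  -- The lower cut of the number `I f` to be constructed.
  let S : R → Set ℝ := fun f => {p | ∃ q : ℚ, (q : ℝ) = p ∧ v (f - q • e)}
  have hbdd : ∀ f, BddAbove (S f) := fun f => by
    obtain ⟨q, -, hq⟩ := he.exists_le_smul f
    refine ⟨q, ?_⟩
    rintro _ ⟨p, rfl, hpv⟩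
    by_contra! hlt
    refine hp.nonpos _ (sub_nonpos.2 (hq.trans (he.smul_le_smul ?_))) hpv
    exact_mod_cast hlt.le
  have hne : ∀ f, (S f).Nonempty := fun f => by
    obtain ⟨q, -, hq⟩ := he.exists_le_smul (-f)
    refine ⟨_, -q - 1, rfl, hp.mono ?_ hp.one⟩
    rw [sub_smul, neg_smul, one_smul]
    have := add_le_add_left (neg_le.1 hq) (q • e + e)
    simpa [add_assoc, sub_eq_add_neg, add_comm, add_left_comm] using this
  have key : ∀ (f : R) (p : ℚ), v (f - p • e) ↔ (p : ℝ) < sSup (S f) := by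
    intro f p
    constructor
    · intro h
      obtain ⟨s, hs, h⟩ := hround _ h
      rw [sub_sub, ← add_smul] at h
      have h1 := le_csSup (hbdd f) ⟨p + s, rfl, h⟩
      have h2 : (0 : ℝ) < s := by exact_mod_cast hs
      push_cast at h1
      linarith
    · intro h
      obtain ⟨_, ⟨q, rfl, hq⟩, hpq⟩ := exists_lt_of_lt_csSup (hne f) h
      exact hp.mono (sub_le_sub_left (he.smul_le_smul (by exact_mod_cast hpq.le)) _) hq
  have hadd : ∀ f g, sSup (S (f + g)) = sSup (S f) + sSup (S g) := by
    intro f g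
    have hfg : ∀ p q : ℚ, f + g - (p + q) • e = (f - p • e) + (g - q • e) := fun p q => by
      rw [add_smul, add_sub_add_comm]
    apply le_antisymm
    · by_contra! hlt
      obtain ⟨p, q, h1, h2, h3⟩ := exists_rat_add_lt hlt
      have h4 : v (f + g - (p + q) • e) := (key _ _).2 (by push_cast; exact h3)
      rw [hfg] at h4
      rcases hp.add _ _ h4 with h | h
      · exact h1.not_gt ((key _ _).1 h)
      · exact h2.not_gt ((key _ _).1 h)
    · by_contra! hlt
      obtain ⟨p, q, h1, h2, h3⟩ := exists_rat_lt_add hlt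
      have h4 := (key _ _).2 h1
      have h5 := (key _ _).2 h2
      -- Superadditivity follows from the subadditivity axiom and the exclusion axiom: `f - p` is
      -- the sum of `f + g - (p + q)` and `-(g - q)`, and the latter cannot be positive.
      have h6 : f - p • e = (f + g - (p + q) • e) + -(g - q • e) := by rw [hfg]; abel
      rw [h6] at h4
      rcases hp.add _ _ h4 with h | h
      · have := (key _ _).1 h
        push_cast at this
        exact h3.not_gt this
      · exact hp.neg _ h5 h
  have hpos : ∀ f, v f ↔ 0 < sSup (S f) := fun f => by
    simpa using key f 0
  refine ⟨AddMonoidHom.mk' (fun f => sSup (S f)) hadd, ⟨fun f hf => ?_, ?_⟩, hpos⟩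
  · by_contra! hlt
    change sSup (S f) < 0 at hlt
    have h1 := hadd f (-f)
    have h0 := hadd 0 0
    rw [add_neg_cancel] at h1
    rw [add_zero] at h0
    exact hp.nonpos (-f) (neg_nonpos.2 hf) ((hpos _).2 (by linarith))
  · change sSup (S e) = 1
    apply le_antisymm
    · by_contra! hlt
      have : v (e - (1 : ℚ) • e) := (key _ _).2 (by simpa using hlt)
      rw [one_smul, sub_self] at this
      exact hp.nonpos 0 le_rfl this
    · by_contra! hlt
      obtain ⟨q, hq, hq1⟩ := exists_rat_btwn hlt
      refine hq.not_gt ((key _ _).1 ?_)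
      nth_rw 1 [← one_smul ℚ e]
      rw [← sub_smul]
      exact hp.smul_unit (sub_pos.2 (by exact_mod_cast hq1)) he

/-! ### Valuations -/

/-- Real-valued normalized continuous valuations on the spectral lattice. -/
structure IsValuation (e : R) (m : Spec e → ℝ) : Prop where
  bot : m ⊥ = 0
  top : m ⊤ = 1
  mono : Monotone m
  modular : ∀ x y, m x + m y = m (x ⊔ y) + m (x ⊓ y)
  scott : ∀ (a : R) (p : ℝ), p < m (Spec.D e a) →
    ∃ ε : ℚ, 0 < ε ∧ p < m (Spec.D e (a - ε • e))

theorem sat_valAddGt {m : Spec e → ℝ} {x y : Spec e} {p : ℚ} :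
    Sat (fun t : ℚ × Spec e => (t.1 : ℝ) < m t.2) (valAddGt e x y p) ↔ (p : ℝ) < m x + m y := by
  simp only [valAddGt, valGt, sat_any, sat_and, sat_atom]
  constructor
  · rintro ⟨⟨⟨r, s⟩, rfl⟩, h1, h2⟩
    push_cast
    exact add_lt_add h1 h2
  · intro h
    obtain ⟨r, s, h1, h2, h3⟩ := exists_rat_lt_add h
    refine ⟨⟨(r, p - r), by simp⟩, h1, ?_⟩
    push_cast
    linarith

namespace IsValuation

variable {m : Spec e → ℝ} (hm : IsValuation e m)

include hm

theorem nonneg (x : Spec e) : 0 ≤ m x := hm.bot ▸ hm.mono bot_le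

theorem le_one (x : Spec e) : m x ≤ 1 := hm.top ▸ hm.mono le_top

/-- A valuation defines a model. -/
theorem isModel : (VAL e).IsModel fun t : ℚ × Spec e => (t.1 : ℝ) < m t.2 := by
  rintro φ ψ (⟨x, p, q, h⟩ | ⟨x, p⟩ | ⟨x, p, h⟩ | ⟨p, h⟩ | ⟨p, h⟩ | ⟨p, h⟩ | ⟨x, y, p⟩ |
    ⟨x, y, p⟩ | ⟨x, y, p, h⟩ | ⟨a, p⟩)
  · exact fun h' => lt_trans (by exact_mod_cast h) h'
  · intro h
    obtain ⟨q, hq, hqx⟩ := exists_rat_btwn (show (p : ℝ) < m x from h)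
    exact sat_any.2 ⟨⟨q, by exact_mod_cast hq⟩, hqx⟩
  · exact fun _ => lt_of_lt_of_le (by exact_mod_cast h) (hm.nonneg x)
  · intro h'
    have h1 : (p : ℝ) < m ⊥ := h'
    have h2 : (0 : ℝ) ≤ p := by exact_mod_cast h
    rw [hm.bot] at h1
    linarith
  · intro h'
    have h1 : (p : ℝ) < m ⊤ := h'
    have h2 : (1 : ℝ) ≤ p := by exact_mod_cast h
    rw [hm.top] at h1
    linarith
  · intro _
    change (p : ℝ) < m ⊤
    rw [hm.top]
    exact_mod_cast h
  · intro h
    exact sat_valAddGt.2 (hm.modular x y ▸ sat_valAddGt.1 h)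
  · intro h
    exact sat_valAddGt.2 ((hm.modular x y).symm ▸ sat_valAddGt.1 h)
  · exact fun h' => lt_of_lt_of_le (show (p : ℝ) < m x from h') (hm.mono h)
  · intro h
    obtain ⟨ε, hε, h⟩ := hm.scott a p h
    exact sat_any.2 ⟨⟨ε, hε⟩, h⟩

end IsValuation

/-- The real number defined by a family of truth values "`p < m`". -/
noncomputable def lowerReal (L : ℚ → Prop) : ℝ := sSup {p : ℝ | ∃ q : ℚ, (q : ℝ) = p ∧ L q}

section LowerReal

variable {L : ℚ → Prop} (hneg : ∀ p < 0, L p) (hone : ∀ p, 1 ≤ p → ¬ L p)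

include hone in
theorem bddAbove_lowerReal : BddAbove {p : ℝ | ∃ q : ℚ, (q : ℝ) = p ∧ L q} := by
  refine ⟨1, ?_⟩
  rintro _ ⟨q, rfl, hq⟩
  by_contra! hlt
  exact hone q (by exact_mod_cast hlt.le) hq

include hone in
theorem le_lowerReal {p : ℚ} (h : L p) : (p : ℝ) ≤ lowerReal L :=
  le_csSup (bddAbove_lowerReal hone) ⟨p, rfl, h⟩

include hneg in
theorem exists_of_lt_lowerReal {p : ℝ} (h : p < lowerReal L) : ∃ q : ℚ, p < q ∧ L q := by
  obtain ⟨_, ⟨q, rfl, hq⟩, hpq⟩ := 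
    exists_lt_of_lt_csSup (by exact ⟨_, -1, rfl, hneg _ (by norm_num)⟩) h
  exact ⟨q, hpq, hq⟩

end LowerReal

/-- Every model of the theory of valuations comes from a valuation. -/
theorem exists_valuation_of_isModel {w : ℚ × Spec e → Prop} (hw : (VAL e).IsModel w) :
    ∃ m : Spec e → ℝ, IsValuation e m ∧ ∀ t, w t ↔ (t.1 : ℝ) < m t.2 := by
  have hdown : ∀ x p q, p < q → w (q, x) → w (p, x) := fun x p q h => hw _ _ (.down x p q h)
  have hneg : ∀ x, ∀ p < 0, w (p, x) := fun x p h => hw _ _ (.nonneg x p h) trivial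
  have hone : ∀ x p, 1 ≤ p → ¬ w (p, x) := fun x p h h' =>
    not_sat_bot (hw _ _ (.top_le p h) (hw _ _ (.mono x ⊤ p le_top) h'))
  have key : ∀ t, w t ↔ (t.1 : ℝ) < lowerReal fun p => w (p, t.2) := by
    rintro ⟨p, x⟩
    constructor
    · intro h
      obtain ⟨⟨q, hpq⟩, hq⟩ := sat_any.1 (hw _ _ (.round x p) h)
      exact lt_of_lt_of_le (by exact_mod_cast hpq) (le_lowerReal (hone x) hq)
    · intro h
      obtain ⟨q, hpq, hq⟩ := exists_of_lt_lowerReal (hneg x) h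
      exact hdown x p q (by exact_mod_cast hpq) hq
  obtain ⟨m, key⟩ : ∃ m : Spec e → ℝ, ∀ t, w t ↔ (t.1 : ℝ) < m t.2 :=
    ⟨fun x => lowerReal fun p => w (p, x), key⟩
  obtain rfl : w = fun t => (t.1 : ℝ) < m t.2 := funext fun t => propext (key t)
  have hle : ∀ {a b : ℝ}, (∀ p : ℚ, (p : ℝ) < a → (p : ℝ) < b) → a ≤ b := fun {a b} h => by
    by_contra! hlt
    obtain ⟨q, hq, hqa⟩ := exists_rat_btwn hlt
    exact hq.not_gt (h q hqa)
  have hmono : Monotone m := fun x y hxy => hle fun p hp => hw _ _ (.mono x y p hxy) hp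
  have hnn : ∀ x, 0 ≤ m x := fun x => hle fun p hp => hneg x p (by exact_mod_cast hp)
  refine ⟨m, ⟨le_antisymm ?_ (hnn _), le_antisymm ?_ ?_, hmono, fun x y => le_antisymm ?_ ?_,
    fun a p hp => ?_⟩, fun t => Iff.rfl⟩
  · exact not_lt.1 fun h => not_sat_bot
      (hw _ _ (.bot_le 0 le_rfl) (show ((0 : ℚ) : ℝ) < m ⊥ by simpa using h))
  · exact not_lt.1 fun h => hone ⊤ 1 le_rfl (by simpa using h)
  · exact hle fun p hp => hw _ _ (.top_ge p (by exact_mod_cast hp)) trivial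
  · exact hle fun p hp => sat_valAddGt.1 (hw _ _ (.modular_le x y p) (sat_valAddGt.2 hp))
  · exact hle fun p hp => sat_valAddGt.1 (hw _ _ (.modular_ge x y p) (sat_valAddGt.2 hp))
  · obtain ⟨q, hq, hqa⟩ := exists_rat_btwn hp
    obtain ⟨⟨ε, hε⟩, h⟩ := sat_any.1 (hw _ _ (.scott a q) hqa)
    exact ⟨ε, hε, hq.trans h⟩

/-! ### The locale of integrals -/

/-- The open `0 < I f` of the locale of integrals. -/
def intOpen (e f : R) : (INT e).Loc := (INT e).opn (atom (G := R) f)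

theorem intOpen_self : intOpen e e = ⊤ :=
  top_le_iff.1 (opn_top.symm.trans_le (opn_le_of_ax (T := INT e) IntAxiom.one))

theorem intOpen_inf_neg (f : R) : intOpen e f ⊓ intOpen e (-f) = ⊥ := by
  refine le_bot_iff.1 ((opn_inf_opn (INT e) _ _).trans_le ?_)
  rw [← opn_bot]
  exact opn_le_of_ax (T := INT e) (IntAxiom.neg f)

theorem intOpen_add_le (f g : R) : intOpen e (f + g) ≤ intOpen e f ⊔ intOpen e g :=
  (opn_le_of_ax (T := INT e) (IntAxiom.add f g)).trans_eq (opn_or (T := INT e) _ _)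

theorem intOpen_of_nonpos {f : R} (h : f ≤ 0) : intOpen e f = ⊥ := by
  rw [intOpen, ← le_bot_iff, ← opn_bot]
  exact opn_le_of_ax (T := INT e) (IntAxiom.nonpos f h)

theorem intOpen_mono {f g : R} (h : f ≤ g) : intOpen e f ≤ intOpen e g := by
  have := intOpen_add_le (e := e) g (f - g)
  rwa [add_sub_cancel, intOpen_of_nonpos (sub_nonpos.2 h), sup_bot_eq] at this

theorem intOpen_nsmul_le (n : ℕ) (f : R) : intOpen e (n • f) ≤ intOpen e f := by
  induction n with
  | zero => rw [zero_smul, intOpen_of_nonpos le_rfl]; exact bot_le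
  | succ n ih => rw [succ_nsmul]; exact (intOpen_add_le _ _).trans (sup_le ih le_rfl)

theorem intOpen_smul_unit (he : IsStrongUnit e) {q : ℚ} (hq : 0 < q) :
    intOpen e (q • e) = ⊤ := by
  obtain ⟨n, hn⟩ := exists_nat_ge (q⁻¹)
  refine top_le_iff.1 (le_trans ?_ (intOpen_nsmul_le n (q • e)))
  rw [← intOpen_self]
  refine intOpen_mono ?_
  rw [← Nat.cast_smul_eq_nsmul ℚ, smul_smul]
  nth_rw 1 [← one_smul ℚ e]
  exact he.smul_le_smul ((inv_le_iff_one_le_mul₀ hq).1 hn)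

/-- The separating open is `I f < p`: it is disjoint from `p < I f`, and it covers the top together
with `q < I f` because `(f - q) + (p - f) = p - q > 0`. -/
theorem intOpen_wellInside (he : IsStrongUnit e) (f : R) {p q : ℚ} (h : q < p) :
    WellInside (intOpen e (f - p • e)) (intOpen e (f - q • e)) := by
  refine WellInside.of_inf_of_sup (intOpen_inf_neg _) (top_le_iff.1 ?_)
  rw [← intOpen_smul_unit he (sub_pos.2 h)]
  refine le_trans (le_of_eq ?_) (intOpen_add_le _ _)
  rw [sub_smul]; congr 1; abel

theorem completelyBelow_intOpen (he : IsStrongUnit e) (f : R) {s : ℚ} (hs : 0 < s) :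
    CompletelyBelow (intOpen e (f - s • e)) (intOpen e f) := by
  refine ⟨fun t => intOpen e (f - ((1 - t) * s) • e), by simp, by simp, fun p q _ hpq _ => ?_⟩
  exact intOpen_wellInside he f (mul_lt_mul_of_pos_right (by linarith) hs)

/-- A prime ideal respects only finite joins, so the infinitary continuity axiom may fail for its
complement; rounding restores it. -/
theorem isPreIntegral_of_isPrime {Q : Order.Ideal (INT e).Loc} (hQ : Q.IsPrime) :
    IsPreIntegral e fun f => intOpen e f ∉ Q where
  one := by rw [intOpen_self]; exact hQ.toIsProper.top_notMem
  neg f h1 h2 := by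
    have : intOpen e f ⊓ intOpen e (-f) ∈ Q := by rw [intOpen_inf_neg]; exact Q.bot_mem
    exact (hQ.mem_or_mem this).elim h1 h2
  add f g h := by
    by_contra! hc
    exact h (Q.lower (intOpen_add_le f g) (Order.Ideal.sup_mem hc.1 hc.2))
  nonpos f hf := by rw [intOpen_of_nonpos hf]; exact not_not.2 Q.bot_mem

theorem isCompactCompletelyRegular_INT (he : IsStrongUnit e) :
    IsCompactCompletelyRegular (INT e).Loc := by
  refine ⟨isCompactElement_top_of_models fun Q hQ => ?_, eq_sSup_completelyBelow fun (f : R) => ?_⟩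
  · refine ⟨_, (isPreIntegral_of_isPrime hQ).isModel_round he, ?_⟩
    rintro (f : R) ⟨s, hs, h⟩
    exact (isPreIntegral_of_isPrime hQ).mono (sub_le_self _ (smul_nonneg hs.le he.nonneg)) h
  · refine (opn_le_of_ax (T := INT e) (IntAxiom.cont_le f)).trans (opn_any_le.2 fun s => ?_)
    exact le_sSup (completelyBelow_intOpen he f s.2)

/-! ### The locale of valuations -/

/-- The open `p < μ x` of the locale of valuations. -/
def valOpen (x : Spec e) (p : ℚ) : (VAL e).Loc := (VAL e).opn (valGt e x p)

theorem valOpen_anti (x : Spec e) {p q : ℚ} (h : p ≤ q) : valOpen x q ≤ valOpen x p := by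
  rcases h.eq_or_lt with rfl | h
  · exact le_rfl
  · exact opn_le_of_ax (T := VAL e) (.down x p q h)

theorem valOpen_mono {x y : Spec e} (h : x ≤ y) (p : ℚ) : valOpen x p ≤ valOpen y p :=
  opn_le_of_ax (T := VAL e) (.mono x y p h)

theorem valOpen_of_neg (x : Spec e) {p : ℚ} (h : p < 0) : valOpen x p = ⊤ :=
  top_le_iff.1 (opn_top.symm.trans_le (opn_le_of_ax (T := VAL e) (.nonneg x p h)))

theorem valOpen_top_of_lt {p : ℚ} (h : p < 1) : valOpen (⊤ : Spec e) p = ⊤ :=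
  top_le_iff.1 (opn_top.symm.trans_le (opn_le_of_ax (T := VAL e) (.top_ge p h)))

theorem valOpen_bot {p : ℚ} (h : 0 ≤ p) : valOpen (⊥ : Spec e) p = ⊥ :=
  le_bot_iff.1 ((opn_le_of_ax (T := VAL e) (.bot_le p h)).trans_eq opn_bot)

theorem valOpen_of_one_le (x : Spec e) {p : ℚ} (h : 1 ≤ p) : valOpen x p = ⊥ :=
  le_bot_iff.1 ((valOpen_mono le_top p).trans
    ((opn_le_of_ax (T := VAL e) (.top_le p h)).trans_eq opn_bot))

theorem valOpen_inf_le_opn_valAddGt (x y : Spec e) {r s p : ℚ} (h : r + s = p) :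
    valOpen x r ⊓ valOpen y s ≤ (VAL e).opn (valAddGt e x y p) := by
  refine (opn_inf_opn (VAL e) _ _).trans_le ?_
  exact opn_le_opn_any (T := VAL e) (fun rs : {rs : ℚ × ℚ // rs.1 + rs.2 = p} =>
    Formula.and (valGt e x rs.1.1) (valGt e y rs.1.2)) ⟨(r, s), h⟩

/-- If `r + s ≤ r' + s'` then `r ≤ r'` or `s ≤ s'`. -/
theorem opn_valAddGt_le_sup (x y : Spec e) {r s p : ℚ} (h : r + s ≤ p) :
    (VAL e).opn (valAddGt e x y p) ≤ valOpen x r ⊔ valOpen y s := by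
  refine opn_any_le.2 ?_
  rintro ⟨⟨r', s'⟩, rfl⟩
  refine (opn_inf_opn (VAL e) _ _).symm.trans_le ?_
  change valOpen x r' ⊓ valOpen y s' ≤ _
  rcases le_or_gt r r' with hr | hr
  · exact inf_le_left.trans ((valOpen_anti x hr).trans le_sup_left)
  · refine inf_le_right.trans ((valOpen_anti y ?_).trans le_sup_right)
    simp only at h
    linarith

theorem opn_valAddGt_sup_inf (x y : Spec e) (p : ℚ) :
    (VAL e).opn (valAddGt e x y p) = (VAL e).opn (valAddGt e (x ⊔ y) (x ⊓ y) p) :=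
  le_antisymm (opn_le_of_ax (T := VAL e) (.modular_le x y p))
    (opn_le_of_ax (T := VAL e) (.modular_ge x y p))

theorem valOpen_inf_eq_bot {x y : Spec e} (h : x ⊓ y = ⊥) {p q : ℚ} (hpq : 1 ≤ p + q) :
    valOpen x p ⊓ valOpen y q = ⊥ := by
  rw [← le_bot_iff]
  refine (valOpen_inf_le_opn_valAddGt x y rfl).trans ?_
  rw [opn_valAddGt_sup_inf, h]
  refine (opn_valAddGt_le_sup (r := 1) (s := 0) _ _ (by linarith)).trans ?_
  rw [valOpen_of_one_le _ le_rfl, valOpen_bot le_rfl, sup_bot_eq]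

theorem valOpen_sup_eq_top {x y : Spec e} (h : x ⊔ y = ⊤) {p q : ℚ} (hpq : p + q < 1) :
    valOpen x p ⊔ valOpen y q = ⊤ := by
  rw [← top_le_iff]
  refine le_trans ?_ (opn_valAddGt_le_sup x y le_rfl)
  rw [opn_valAddGt_sup_inf, h]
  -- As `p + q < 1`, it splits into a summand below 1, granted by `μ ⊤ = 1`, and a summand below 0,
  -- granted by nonnegativity.
  refine le_trans ?_ (valOpen_inf_le_opn_valAddGt (r := (p + q) / 2 + 1 / 2)
    (s := (p + q) / 2 - 1 / 2) _ _ (by ring))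
  rw [valOpen_top_of_lt (by linarith), valOpen_of_neg _ (by linarith), inf_top_eq]

/-- The separating open is `1 - p < μ (a < ε)`. Slack is needed in both parameters: `δ < ε` so that
the two spectral opens cover the spectrum, `q < p` so that the masses required stay below 1. -/
theorem valOpen_wellInside (he : IsStrongUnit e) (a : R) {p q δ ε : ℚ} (hpq : q < p)
    (hδε : δ < ε) :
    WellInside (valOpen (Spec.D e (a - ε • e)) p) (valOpen (Spec.D e (a - δ • e)) q) := by
  refine WellInside.of_inf_of_sup (w := valOpen (Spec.D e (ε • e - a)) (1 - p))
    (valOpen_inf_eq_bot (Spec.D_sub_unit_inf he a le_rfl) (by linarith)) ?_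
  rw [sup_comm]
  exact valOpen_sup_eq_top (Spec.D_sub_unit_sup a hδε) (by linarith)

theorem completelyBelow_valOpen (he : IsStrongUnit e) (a : R) {p q ε : ℚ} (hpq : q < p)
    (hε : 0 < ε) :
    CompletelyBelow (valOpen (Spec.D e (a - ε • e)) p) (valOpen (Spec.D e a) q) := by
  refine ⟨fun t => valOpen (Spec.D e (a - ((1 - t) * ε) • e)) (p - t * (p - q)), by simp, by simp,
    fun s t _ hst _ => ?_⟩
  refine valOpen_wellInside he a ?_ (mul_lt_mul_of_pos_right (by linarith) hε)
  have := mul_lt_mul_of_pos_right hst (sub_pos.2 hpq)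
  linarith

/-- Roundness supplies the slack in `p` and Scott continuity the slack in `a` that a scale requires.
-/
theorem valOpen_le_sSup (he : IsStrongUnit e) (x : Spec e) (p : ℚ) :
    valOpen x p ≤ sSup {z | CompletelyBelow z (valOpen x p)} := by
  obtain ⟨a, rfl⟩ := Spec.exists_D_eq x
  refine (opn_le_of_ax (T := VAL e) (.round _ p)).trans (opn_any_le.2 fun q => ?_)
  refine (opn_le_of_ax (T := VAL e) (.scott a q.1)).trans (opn_any_le.2 fun ε => ?_)
  exact le_sSup (completelyBelow_valOpen he a q.2 ε.2)

/-! ### The possibly discontinuous valuation attached to a prime ideal of opens -/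

section Prime

variable {Q : Order.Ideal (VAL e).Loc} (hQ : Q.IsPrime)

/-- The real numbers determined by a prime ideal of opens. -/
noncomputable def primeVal (Q : Order.Ideal (VAL e).Loc) (x : Spec e) : ℝ :=
  lowerReal fun p => valOpen x p ∉ Q

include hQ

theorem valOpen_notMem_of_neg (x : Spec e) : ∀ p < 0, valOpen x p ∉ Q := fun p hp => by
  rw [valOpen_of_neg x hp]; exact hQ.toIsProper.top_notMem

omit hQ in
theorem valOpen_mem_of_one_le (x : Spec e) : ∀ p, 1 ≤ p → ¬ valOpen x p ∉ Q := fun p hp => by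
  rw [valOpen_of_one_le x hp]; exact not_not.2 Q.bot_mem

omit hQ in
theorem le_primeVal {x : Spec e} {p : ℚ} (h : valOpen x p ∉ Q) : (p : ℝ) ≤ primeVal Q x :=
  le_lowerReal (valOpen_mem_of_one_le x) h

theorem valOpen_notMem_of_lt {x : Spec e} {p : ℚ} (h : (p : ℝ) < primeVal Q x) :
    valOpen x p ∉ Q := by
  obtain ⟨q, hpq, hq⟩ := exists_of_lt_lowerReal (valOpen_notMem_of_neg hQ x) h
  exact fun hp => hq (Q.lower (valOpen_anti x (by exact_mod_cast hpq.le)) hp)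

theorem primeVal_le_of_rat {x : Spec e} {b : ℝ}
    (h : ∀ p : ℚ, (p : ℝ) < primeVal Q x → (p : ℝ) ≤ b) : primeVal Q x ≤ b := by
  by_contra! hlt
  obtain ⟨q, hq, hqx⟩ := exists_rat_btwn hlt
  exact hq.not_ge (h q hqx)

theorem primeVal_mono : Monotone (primeVal Q) := fun _ _ hxy =>
  primeVal_le_of_rat hQ fun p hp =>
    le_primeVal fun hy => valOpen_notMem_of_lt hQ hp (Q.lower (valOpen_mono hxy p) hy)

theorem primeVal_bot : primeVal Q ⊥ = 0 := by
  refine le_antisymm (primeVal_le_of_rat hQ fun p hp => ?_) ?_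
  · by_contra! h0
    refine valOpen_notMem_of_lt hQ hp ?_
    rw [valOpen_bot (by exact_mod_cast h0.le)]
    exact Q.bot_mem
  · by_contra! h0
    obtain ⟨q, hq, hq0⟩ := exists_rat_btwn h0
    exact hq.not_ge (le_primeVal (valOpen_notMem_of_neg hQ _ q (by exact_mod_cast hq0)))

theorem primeVal_top : primeVal Q ⊤ = 1 := by
  refine le_antisymm (primeVal_le_of_rat hQ fun p hp => ?_) ?_
  · by_contra! h1
    exact valOpen_mem_of_one_le _ p (by exact_mod_cast h1.le) (valOpen_notMem_of_lt hQ hp)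
  · by_contra! h1
    obtain ⟨q, hq, hq1⟩ := exists_rat_btwn h1
    refine hq.not_ge (le_primeVal ?_)
    rw [valOpen_top_of_lt (by exact_mod_cast hq1)]
    exact hQ.toIsProper.top_notMem

theorem opn_valAddGt_notMem {x y : Spec e} {p : ℚ} (h : (p : ℝ) < primeVal Q x + primeVal Q y) :
    (VAL e).opn (valAddGt e x y p) ∉ Q := by
  obtain ⟨r, s, hr, hs, hrs⟩ := exists_rat_lt_add h
  intro hmem
  have hs' : ((p - r : ℚ) : ℝ) < primeVal Q y := by push_cast; linarith
  exact (hQ.mem_or_mem (Q.lower (valOpen_inf_le_opn_valAddGt x y (add_sub_cancel r p)) hmem)).elim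
    (valOpen_notMem_of_lt hQ hr) (valOpen_notMem_of_lt hQ hs')

omit hQ in
theorem le_of_opn_valAddGt_notMem {x y : Spec e} {p : ℚ}
    (h : (VAL e).opn (valAddGt e x y p) ∉ Q) : (p : ℝ) ≤ primeVal Q x + primeVal Q y := by
  by_contra! hlt
  obtain ⟨r, s, hr, hs, hrs⟩ := exists_rat_add_lt hlt
  refine h (Q.lower (opn_valAddGt_le_sup x y (r := r) (s := s) (by exact_mod_cast hrs.le)) ?_)
  refine Order.Ideal.sup_mem ?_ ?_
  · by_contra hc; exact hr.not_ge (le_primeVal hc)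
  · by_contra hc; exact hs.not_ge (le_primeVal hc)

/-- The ideal decides the formula `p < μ x + μ y` whenever `p` differs from the sum of the two
values. The undecided boundary case is harmless since rationals are dense. -/
theorem primeVal_modular (x y : Spec e) :
    primeVal Q x + primeVal Q y = primeVal Q (x ⊔ y) + primeVal Q (x ⊓ y) := by
  apply le_antisymm
  · by_contra! hlt
    obtain ⟨p, hp, hp'⟩ := exists_rat_btwn hlt
    have := opn_valAddGt_notMem hQ hp'
    rw [opn_valAddGt_sup_inf] at this
    exact hp.not_ge (le_of_opn_valAddGt_notMem this)
  · by_contra! hlt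
    obtain ⟨p, hp, hp'⟩ := exists_rat_btwn hlt
    have := opn_valAddGt_notMem hQ hp'
    rw [← opn_valAddGt_sup_inf] at this
    exact hp.not_ge (le_of_opn_valAddGt_notMem this)

end Prime

/-- Normalized valuations that need not be continuous. -/
structure IsPreValuation (e : R) (m : Spec e → ℝ) : Prop where
  bot : m ⊥ = 0
  top : m ⊤ = 1
  mono : Monotone m
  modular : ∀ x y, m x + m y = m (x ⊔ y) + m (x ⊓ y)

theorem isPreValuation_primeVal {Q : Order.Ideal (VAL e).Loc} (hQ : Q.IsPrime) :
    IsPreValuation e (primeVal Q) :=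
  ⟨primeVal_bot hQ, primeVal_top hQ, primeVal_mono hQ, primeVal_modular hQ⟩

/-- The continuous part of a valuation. -/
theorem IsPreValuation.exists_isValuation_le (he : IsStrongUnit e) {m : Spec e → ℝ}
    (hm : IsPreValuation e m) : ∃ m' : Spec e → ℝ, IsValuation e m' ∧ ∀ x, m' x ≤ m x := by
  let s : R → ℕ → ℝ := fun a n => m (Spec.D e (a - (1 / ((n : ℚ) + 1)) • e))
  let r : R → ℝ := fun a => ⨆ n, s a n
  have hone : ∀ x, m x ≤ 1 := fun x => hm.top ▸ hm.mono le_top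
  have hbdd : ∀ a, BddAbove (Set.range (s a)) := fun a =>
    ⟨1, by rintro _ ⟨n, rfl⟩; exact hone _⟩
  have hmono : ∀ a, Monotone (s a) := fun a k n hkn => hm.mono
    (Spec.D_sub_smul_anti he a (one_div_le_one_div_of_le (by positivity) (by gcongr)))
  have htend : ∀ a, Tendsto (s a) atTop (𝓝 (r a)) := fun a =>
    tendsto_atTop_ciSup (hmono a) (hbdd a)
  have hle : ∀ a (δ : ℚ), 0 < δ → m (Spec.D e (a - δ • e)) ≤ r a := fun a δ hδ => by
    obtain ⟨n, hn⟩ := exists_nat_one_div_lt hδ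
    exact (hm.mono (Spec.D_sub_smul_anti he a hn.le)).trans (le_ciSup (hbdd a) n)
  have hrm : ∀ a, r a ≤ m (Spec.D e a) := fun a => ciSup_le fun n =>
    hm.mono (Spec.D_mono (sub_le_self _ (smul_nonneg (by positivity) he.nonneg)))
  have hD : ∀ a b, Spec.D e a ≤ Spec.D e b → r a ≤ r b := fun a b hab => ciSup_le fun n => by
    obtain ⟨δ, hδ, h⟩ := Spec.exists_D_sub_le_D_sub he hab
      (show (0 : ℚ) < 1 / ((n : ℚ) + 1) by positivity)
    exact (hm.mono h).trans (hle b δ hδ)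
  -- By `hD` the number `r a` depends only on `D a`, so the choice of generators is immaterial.
  choose rep hrep using Spec.exists_D_eq (e := e)
  have hr : ∀ a, r (rep (Spec.D e a)) = r a := fun a =>
    le_antisymm (hD _ _ (hrep _).le) (hD _ _ (hrep _).ge)
  refine ⟨fun x => r (rep x), ⟨?_, ?_, ?_, ?_, ?_⟩, fun x => (hrm _).trans_eq (by rw [hrep])⟩
  · have h0 : Spec.D e (0 : R) = ⊥ := Spec.D_of_nonpos le_rfl
    change r (rep ⊥) = 0
    rw [← h0, hr]
    refine le_antisymm ((hrm 0).trans_eq (by rw [h0, hm.bot])) ?_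
    rw [← hm.bot]
    exact (hm.mono bot_le).trans (hle 0 1 one_pos)
  · rw [← Spec.D_self, hr]
    refine le_antisymm ((hrm e).trans (hone _)) ?_
    refine le_of_eq_of_le ?_ (hle e (1 / 2) (by norm_num))
    have : e - (1 / 2 : ℚ) • e = (1 / 2 : ℚ) • e := by
      nth_rw 1 [← one_smul ℚ e]
      rw [← sub_smul]
      norm_num
    rw [this, Spec.D_smul_unit (by norm_num), hm.top]
  · intro x y hxy
    exact hD _ _ (by rwa [hrep, hrep])
  · intro x y
    obtain ⟨a, rfl⟩ := Spec.exists_D_eq x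
    obtain ⟨b, rfl⟩ := Spec.exists_D_eq y
    rw [← Spec.D_sup, ← Spec.D_inf]
    simp only [hr]
    refine tendsto_nhds_unique ((htend a).add (htend b)) ?_
    refine ((htend (a ⊔ b)).add (htend (a ⊓ b))).congr fun n => ?_
    simp only [s]
    rw [sup_sub, inf_sub, Spec.D_sup, Spec.D_inf, ← hm.modular]
  · intro a p hp
    rw [hr] at hp
    obtain ⟨n, hn⟩ := exists_lt_of_lt_ciSup hp
    -- Half of the shift `1 / (n + 1)` serves as `ε`; the other half is absorbed by the supremum
    -- through `hle`.
    refine ⟨1 / ((n : ℚ) + 1) / 2, by positivity, ?_⟩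
    rw [hr]
    refine hn.trans_le (le_of_eq_of_le ?_ (hle _ (1 / ((n : ℚ) + 1) / 2) (by positivity)))
    rw [sub_sub, ← add_smul, add_halves]

theorem isCompactCompletelyRegular_VAL (he : IsStrongUnit e) :
    IsCompactCompletelyRegular (VAL e).Loc := by
  refine ⟨isCompactElement_top_of_models fun Q hQ => ?_,
    eq_sSup_completelyBelow fun t => valOpen_le_sSup he t.2 t.1⟩
  obtain ⟨m, hm, hle⟩ := (isPreValuation_primeVal hQ).exists_isValuation_le he
  exact ⟨_, hm.isModel, fun t ht => valOpen_notMem_of_lt hQ (ht.trans_le (hle t.2))⟩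

/-! ### From integrals to valuations -/

theorem smul_sup_of_nonneg {q : ℚ} (hq : 0 ≤ q) (a b : R) : q • (a ⊔ b) = q • a ⊔ q • b := by
  rcases hq.eq_or_lt with rfl | hq
  · simp
  · exact smul_sup_of_pos hq a b

theorem smul_inf_of_nonneg {q : ℚ} (hq : 0 ≤ q) (a b : R) : q • (a ⊓ b) = q • a ⊓ q • b := by
  rcases hq.eq_or_lt with rfl | hq
  · simp
  · exact smul_inf_of_pos hq a b

theorem posPart_sup_eq (a b : R) : (a ⊔ b)⁺ = a⁺ ⊔ b⁺ := by
  simp only [posPart_def]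
  rw [sup_sup_distrib_right]

theorem posPart_inf_eq (a b : R) : (a ⊓ b)⁺ = a⁺ ⊓ b⁺ :=
  letI := AddCommGroup.toDistribLattice R
  sup_inf_right a b 0

theorem add_inf_le {a b c : R} (hc : 0 ≤ c) : (a + c) ⊓ b ≤ a ⊓ b + c := by
  rw [inf_add]
  exact inf_le_inf le_rfl (le_add_of_nonneg_right hc)

/-- Both elements are dominated by their multiples by the common factor `max q 1`, and the meet of
these is a multiple of `a ⊓ b`. -/
theorem smul_inf_eq_zero {a b : R} (ha : 0 ≤ a) (hb : 0 ≤ b) (h : a ⊓ b = 0) {q : ℚ}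
    (hq : 0 ≤ q) : q • a ⊓ b = 0 := by
  refine le_antisymm ?_ (le_inf (smul_nonneg hq ha) hb)
  calc q • a ⊓ b ≤ (max q 1) • a ⊓ (max q 1) • b := by
        refine inf_le_inf (smul_le_smul_of_nonneg_right (le_max_left _ _) ha) ?_
        nth_rw 1 [← one_smul ℚ b]
        exact smul_le_smul_of_nonneg_right (le_max_right _ _) hb
    _ = 0 := by rw [← smul_inf_of_nonneg (hq.trans (le_max_left _ _)), h, smul_zero]

theorem posPart_sub_smul_le (he : IsStrongUnit e) (a : R) {ε : ℚ} (hε : 0 ≤ ε) :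
    a⁺ ≤ (a - ε • e)⁺ + ε • e := by
  rw [posPart_def, posPart_def, sup_add, sub_add_cancel, zero_add]
  exact sup_le_sup_left (smul_nonneg hε he.nonneg) _

/-- `d (q x⁺ ∧ e) + x⁺ ≤ (x + d e)⁺`. -/
theorem smul_inf_add_posPart_le (he : IsStrongUnit e) (x : R) {d q : ℚ} (hd : 0 ≤ d)
    (hq : 0 ≤ q) : d • ((q • x⁺) ⊓ e) + x⁺ ≤ (x + d • e)⁺ := by
  set w := d • ((q • x⁺) ⊓ e) with hw
  -- As `w` is disjoint from `x⁻`, their sum is their join, which can be bounded termwise.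
  have h1 : w ⊓ x⁻ = 0 := by
    have h0 : (q • x⁺) ⊓ e ⊓ x⁻ = 0 := by
      refine le_antisymm ?_ (le_inf (le_inf (smul_nonneg hq (posPart_nonneg x)) he.nonneg)
        (negPart_nonneg x))
      rw [← smul_inf_eq_zero (posPart_nonneg x) (negPart_nonneg x)
        (posPart_inf_negPart_eq_zero x) hq]
      exact inf_le_inf_right _ inf_le_left
    exact smul_inf_eq_zero (le_inf (smul_nonneg hq (posPart_nonneg x)) he.nonneg)
      (negPart_nonneg x) h0 hd
  have h2 : w + x⁻ ≤ d • e ⊔ x⁻ := by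
    rw [← inf_add_sup, h1, zero_add]
    exact sup_le_sup_right (smul_le_smul_of_nonneg_left inf_le_right hd) _
  calc w + x⁺ = w + x⁻ + x := by
        nth_rw 3 [← posPart_sub_negPart x]
        abel
    _ ≤ (d • e ⊔ x⁻) + x := add_le_add_left h2 x
    _ = (x + d • e) ⊔ x⁺ := by
        rw [sup_add, add_comm (d • e)]
        congr 1
        nth_rw 2 [← posPart_sub_negPart x]
        abel
    _ ≤ (x + d • e)⁺ := sup_le (le_posPart _)
        (posPart_mono (le_add_of_nonneg_right (smul_nonneg hd he.nonneg)))

/-- `(x + d e)⁺ ≤ d (q (x + d e)⁺ ∧ e) + x⁺` when `1 ≤ q d`. -/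
theorem posPart_le_smul_inf_add (he : IsStrongUnit e) (x : R) {d q : ℚ} (hd : 0 ≤ d)
    (hq : 1 ≤ d * q) : (x + d • e)⁺ ≤ d • ((q • (x + d • e)⁺) ⊓ e) + x⁺ := by
  -- The right side becomes the meet of `d q (x + d e)⁺ + x⁺` and `d e + x⁺`; each dominates `(x + d
  -- e)⁺`, the first because `1 ≤ d q`.
  rw [smul_inf_of_nonneg hd, smul_smul, inf_add]
  refine le_inf (le_add_of_le_of_nonneg ?_ (posPart_nonneg _)) ?_
  · nth_rw 1 [← one_smul ℚ (x + d • e)⁺]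
    exact smul_le_smul_of_nonneg_right hq (posPart_nonneg _)
  · have := posPart_sub_smul_le he (x + d • e) hd
    rw [add_sub_cancel_right] at this
    exact this.trans_eq (add_comm _ _)

namespace Spec

/-- A generator representing a given element of the spectral lattice. -/
noncomputable def rep (x : Spec e) : R := (exists_D_eq x).choose

theorem D_rep (x : Spec e) : D e (rep x) = x := (exists_D_eq x).choose_spec

end Spec

/-- The valuation `μ (D a) = sup_n I (n a⁺ ∧ 1)` defined by an integral. -/
noncomputable def intVal (I : R →+ ℝ) (x : Spec e) : ℝ := ⨆ n : ℕ, I ((n • (Spec.rep x)⁺) ⊓ e)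

namespace IsIntegral

variable {I : R →+ ℝ} (hI : IsIntegral e I)

include hI

theorem bddAbove_range (a : R) : BddAbove (Set.range fun n : ℕ => I ((n • a⁺) ⊓ e)) :=
  ⟨1, by rintro _ ⟨n, rfl⟩; exact (hI.mono inf_le_right).trans_eq hI.unit⟩

theorem le_iSup_of_smul (a : R) (q : ℚ) : I ((q • a⁺) ⊓ e) ≤ ⨆ n : ℕ, I ((n • a⁺) ⊓ e) := by
  obtain ⟨n, hn⟩ := exists_nat_ge q
  refine le_trans (hI.mono (inf_le_inf_right _ ?_)) (le_ciSup (hI.bddAbove_range a) n)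
  rw [← Nat.cast_smul_eq_nsmul ℚ]
  exact smul_le_smul_of_nonneg_right hn (posPart_nonneg a)

theorem iSup_le_iSup_of_D_le (he : IsStrongUnit e) {a b : R} (h : Spec.D e a ≤ Spec.D e b) :
    ⨆ n : ℕ, I ((n • a⁺) ⊓ e) ≤ ⨆ n : ℕ, I ((n • b⁺) ⊓ e) := by
  obtain ⟨q, hq, hab⟩ := Spec.posPart_le_smul_of_D_le he h
  refine ciSup_le fun n => ?_
  refine le_trans (hI.mono (inf_le_inf_right _ ?_)) (hI.le_iSup_of_smul b (n * q))
  rw [← smul_smul, Nat.cast_smul_eq_nsmul]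
  exact nsmul_le_nsmul_right hab n

theorem intVal_D (he : IsStrongUnit e) (a : R) :
    intVal I (Spec.D e a) = ⨆ n : ℕ, I ((n • a⁺) ⊓ e) :=
  le_antisymm (hI.iSup_le_iSup_of_D_le he (Spec.D_rep _).le)
    (hI.iSup_le_iSup_of_D_le he (Spec.D_rep _).ge)

theorem le_intVal (he : IsStrongUnit e) (a : R) (q : ℚ) :
    I ((q • a⁺) ⊓ e) ≤ intVal I (Spec.D e a) :=
  (hI.le_iSup_of_smul a q).trans_eq (hI.intVal_D he a).symm

theorem tendsto_intVal (he : IsStrongUnit e) (a : R) :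
    Tendsto (fun n : ℕ => I ((n • a⁺) ⊓ e)) atTop (𝓝 (intVal I (Spec.D e a))) := by
  rw [hI.intVal_D he]
  refine tendsto_atTop_ciSup (fun k n hkn => hI.mono (inf_le_inf_right _ ?_)) (hI.bddAbove_range a)
  exact nsmul_le_nsmul_left (posPart_nonneg a) hkn

theorem isValuation_intVal (he : IsStrongUnit e) : IsValuation e (intVal I) where
  bot := by
    rw [← Spec.D_of_nonpos (le_refl (0 : R)), hI.intVal_D he]
    simp [inf_eq_left.2 he.nonneg]
  top := by
    rw [← Spec.D_self]
    refine le_antisymm ?_ ?_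
    · rw [hI.intVal_D he]
      exact ciSup_le fun n => (hI.mono inf_le_right).trans_eq hI.unit
    · refine le_of_eq_of_le ?_ (hI.le_intVal he e 1)
      rw [one_smul, posPart_of_nonneg he.nonneg, inf_idem, hI.unit]
  mono x y hxy := hI.iSup_le_iSup_of_D_le he (by rwa [Spec.D_rep, Spec.D_rep])
  modular x y := by
    obtain ⟨a, rfl⟩ := Spec.exists_D_eq x
    obtain ⟨b, rfl⟩ := Spec.exists_D_eq y
    rw [← Spec.D_sup, ← Spec.D_inf]
    refine tendsto_nhds_unique ((hI.tendsto_intVal he a).add (hI.tendsto_intVal he b)) ?_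
    refine ((hI.tendsto_intVal he (a ⊔ b)).add (hI.tendsto_intVal he (a ⊓ b))).congr fun n => ?_
    -- The identity holds already for fixed `n`: it is `u + v = u ⊓ v + u ⊔ v` for `u = n a⁺ ∧ e`
    -- and `v = n b⁺ ∧ e`.
    rw [← map_add, ← map_add, posPart_sup_eq, posPart_inf_eq]
    simp only [← Nat.cast_smul_eq_nsmul ℚ n]
    rw [smul_sup_of_nonneg n.cast_nonneg, smul_inf_of_nonneg n.cast_nonneg, add_comm,
      ← inf_add_sup ((n : ℚ) • a⁺ ⊓ e)]
    congr 2
    · exact inf_inf_distrib_right _ _ _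
    · rw [inf_comm, inf_sup_distrib, inf_comm e, inf_comm e]
  scott a p hp := by
    rw [hI.intVal_D he] at hp
    obtain ⟨n, hn⟩ := exists_lt_of_lt_ciSup hp
    -- Replacing `a` by `a - ε` lowers `n a⁺ ∧ e` by at most `n ε`, so `n ε` must stay below the
    -- slack.
    obtain ⟨ε, hε, hεn⟩ : ∃ ε : ℚ, 0 < ε ∧ (n * ε : ℝ) < I ((n • a⁺) ⊓ e) - p := by
      obtain ⟨δ, hδ, hδ'⟩ := exists_rat_btwn (sub_pos.2 hn)
      have hδ0 : (0 : ℚ) < δ := by exact_mod_cast hδ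
      refine ⟨δ / (n + 1), by positivity, lt_of_le_of_lt ?_ hδ'⟩
      push_cast
      rw [mul_div_assoc', div_le_iff₀ (by positivity)]
      nlinarith
    refine ⟨ε, hε, lt_of_lt_of_le ?_ (hI.le_intVal he (a - ε • e) n)⟩
    have h1 : (n • a⁺) ⊓ e ≤ ((n : ℚ) • (a - ε • e)⁺) ⊓ e + (n * ε) • e := by
      refine le_trans (inf_le_inf_right _ ?_)
        (add_inf_le (smul_nonneg (by positivity) he.nonneg))
      rw [← Nat.cast_smul_eq_nsmul ℚ, ← smul_smul, ← smul_add]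
      exact smul_le_smul_of_nonneg_left (posPart_sub_smul_le he a hε.le) n.cast_nonneg
    have h2 := hI.mono h1
    rw [map_add, hI.smul_unit] at h2
    push_cast at h2
    linarith

/-- `(t - s) μ (t < f) ≤ I ((f - s)⁺) - I ((f - t)⁺)`. -/
theorem mul_intVal_above_le (he : IsStrongUnit e) (f : R) {s t : ℚ} (hst : s < t) :
    ((t : ℝ) - s) * intVal I (above e f t) ≤ I (f - s • e)⁺ - I (f - t • e)⁺ := by
  have hd : (0 : ℝ) < t - s := sub_pos.2 (by exact_mod_cast hst)
  rw [above, hI.intVal_D he, ← le_div_iff₀' hd]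
  refine ciSup_le fun n => ?_
  rw [le_div_iff₀' hd]
  have h := hI.mono (smul_inf_add_posPart_le he (f - t • e) (sub_pos.2 hst).le
    (Nat.cast_nonneg (α := ℚ) n))
  rw [map_add, map_rat_smul, Nat.cast_smul_eq_nsmul, Rat.smul_def] at h
  rw [show f - t • e + (t - s) • e = f - s • e by rw [sub_smul]; abel] at h
  push_cast at h
  linarith

/-- `I ((f - s)⁺) - I ((f - t)⁺) ≤ (t - s) μ (s < f)`. -/
theorem le_mul_intVal_above (he : IsStrongUnit e) (f : R) {s t : ℚ} (hst : s < t) :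
    I (f - s • e)⁺ - I (f - t • e)⁺ ≤ ((t : ℝ) - s) * intVal I (above e f s) := by
  have hd : (0 : ℝ) < t - s := sub_pos.2 (by exact_mod_cast hst)
  have hd' : 0 < t - s := sub_pos.2 hst
  have h := hI.mono (posPart_le_smul_inf_add he (f - t • e) (q := (t - s)⁻¹) hd'.le
    (mul_inv_cancel₀ hd'.ne').ge)
  rw [map_add, map_rat_smul, Rat.smul_def,
    show f - t • e + (t - s) • e = f - s • e by rw [sub_smul]; abel] at h
  have h2 := mul_le_mul_of_nonneg_left (hI.le_intVal he (f - s • e) (t - s)⁻¹) hd.le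
  push_cast at h
  rw [above]
  linarith

end IsIntegral

/-! ### Riemann-Stieltjes sums -/

theorem sum_fin_sub {n : ℕ} (u : Fin (n + 1) → ℝ) :
    ∑ i : Fin n, (u i.castSucc - u i.succ) = u 0 - u (Fin.last n) := by
  rw [Finset.sum_sub_distrib]
  have h1 := Fin.sum_univ_succ u
  have h2 := Fin.sum_univ_castSucc u
  linarith

theorem exists_rat_lt_sum {n : ℕ} {c : Fin n → ℚ} (hc : ∀ i, 0 ≤ c i) {a : Fin n → ℝ} {p : ℝ}
    (h : p < ∑ i, (c i : ℝ) * a i) :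
    ∃ r : Fin n → ℚ, (∀ i, (r i : ℝ) < a i) ∧ p < ∑ i, (c i : ℝ) * r i := by
  have hC : 0 ≤ ∑ i, (c i : ℝ) := Finset.sum_nonneg fun i _ => by exact_mod_cast hc i
  set C := ∑ i, (c i : ℝ)
  -- Lowering each `a i` by at most `ρ` costs at most `C ρ`, less than the slack; `C + 1` also
  -- avoids division by zero.
  set ρ := ((∑ i, (c i : ℝ) * a i) - p) / (C + 1) with hρ
  have hρ0 : 0 < ρ := div_pos (sub_pos.2 h) (by linarith)
  have hρC : ρ * (C + 1) = (∑ i, (c i : ℝ) * a i) - p := div_mul_cancel₀ _ (by linarith)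
  choose r hr hra using fun i => exists_rat_btwn (sub_lt_self (a i) hρ0)
  refine ⟨r, hra, ?_⟩
  have h1 : ∑ i, (c i : ℝ) * (a i - ρ) ≤ ∑ i, (c i : ℝ) * r i :=
    Finset.sum_le_sum fun i _ =>
      mul_le_mul_of_nonneg_left (hr i).le (by exact_mod_cast hc i)
  have h2 : ∑ i, (c i : ℝ) * (a i - ρ) = (∑ i, (c i : ℝ) * a i) - C * ρ := by
    rw [Finset.sum_mul, ← Finset.sum_sub_distrib]
    exact Finset.sum_congr rfl fun i _ => mul_sub _ _ _
  nlinarith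

theorem exists_rat_sum_lt {n : ℕ} {c : Fin n → ℚ} (hc : ∀ i, 0 ≤ c i) {a : Fin n → ℝ} {q : ℝ}
    (h : ∑ i, (c i : ℝ) * a i < q) :
    ∃ r : Fin n → ℚ, (∀ i, a i < r i) ∧ ∑ i, (c i : ℝ) * r i < q := by
  obtain ⟨r, hr, hq⟩ := exists_rat_lt_sum hc (a := fun i => -a i) (p := -q) (by simpa using h)
  refine ⟨fun i => -r i, fun i => ?_, ?_⟩
  · push_cast
    linarith [hr i]
  · push_cast
    simp only [mul_neg, Finset.sum_neg_distrib]
    linarith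

namespace RatPartition

variable {b : ℚ} (P : RatPartition b)

theorem nonneg (i : Fin (P.n + 1)) : 0 ≤ P.s i := P.first ▸ P.strictMono.monotone (Fin.zero_le i)

theorem le_last (i : Fin (P.n + 1)) : P.s i ≤ b := by
  conv_rhs => rw [← P.last]
  exact P.strictMono.monotone (Fin.le_last i)

theorem lt_succ (i : Fin P.n) : P.s i.castSucc < P.s i.succ := P.strictMono (Fin.castSucc_lt_succ)

end RatPartition

/-- The distribution function `F t = μ (t < f)`, its companion `G t = μ (f < t)`, and the
function `H t = I ((f - t)⁺)`, on `[0, b]`. -/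
structure IsDistribution (b : ℚ) (F G H : ℚ → ℝ) : Prop where
  F_anti : Antitone F
  F_nonneg : ∀ t, 0 ≤ F t
  F_le_one : ∀ t, F t ≤ 1
  add_le : ∀ t, F t + G t ≤ 1
  le_add : ∀ s t : ℚ, s < t → 1 ≤ F s + G t
  le_sub : ∀ s t : ℚ, s < t → ((t : ℝ) - s) * F t ≤ H s - H t
  sub_le : ∀ s t : ℚ, s < t → H s - H t ≤ ((t : ℝ) - s) * F s
  F_last : F b = 0
  G_last : G b = 1
  H_last : H b = 0

namespace IsDistribution

variable {b : ℚ} {F G H : ℚ → ℝ} (h : IsDistribution b F G H)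

include h

/-- Summation by parts: `t F(t) + H(t)` stands for the integral of `f` over `(t < f)`, and its
decrement over an interval is the contribution that both Stieltjes sums approximate. -/
theorem sum_sub (P : RatPartition b) :
    ∑ i : Fin P.n, ((P.s i.castSucc * F (P.s i.castSucc) + H (P.s i.castSucc)) -
      (P.s i.succ * F (P.s i.succ) + H (P.s i.succ))) = H 0 := by
  rw [sum_fin_sub fun i => P.s i * F (P.s i) + H (P.s i), P.first, P.last, h.F_last, h.H_last]
  simp

/-- Termwise: `add_le` bounds a term by `s_i (F(s_i) - F(s_{i+1}))`, and `le_sub` bounds this by the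
decrement of `t F(t) + H(t)`. -/
theorem lowerSum_le (P : RatPartition b) :
    ∑ i : Fin P.n, (P.s i.castSucc : ℝ) * (F (P.s i.castSucc) + G (P.s i.succ) - 1) ≤ H 0 := by
  rw [← h.sum_sub P]
  refine Finset.sum_le_sum fun i _ => ?_
  have h0 : (0 : ℝ) ≤ P.s i.castSucc := by exact_mod_cast P.nonneg _
  have h1 := h.add_le (P.s i.succ)
  have h2 := h.le_sub _ _ (P.lt_succ i)
  have h4 := mul_le_mul_of_nonneg_left h1 h0
  nlinarith

theorem le_upperSum (P : RatPartition b) :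
    H 0 ≤ ∑ i : Fin P.n, (P.s i.succ : ℝ) * (1 - (G (P.s i.castSucc) + F (P.s i.succ))) := by
  rw [← h.sum_sub P]
  refine Finset.sum_le_sum fun i _ => ?_
  have h0 : (0 : ℝ) ≤ P.s i.succ := by exact_mod_cast P.nonneg _
  have h1 := h.add_le (P.s i.castSucc)
  have h2 := h.sub_le _ _ (P.lt_succ i)
  have h4 := mul_le_mul_of_nonneg_left h1 h0
  nlinarith

/-- Every interval contains points of small mass. -/
theorem exists_small_gap {s t : ℚ} (hst : s < t) {η : ℝ} (hη : 0 < η) :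
    ∃ r, s ≤ r ∧ r < t ∧ 1 - F r - G r ≤ η := by
  -- If every point had mass `1 - F - G` above `η`, then along `N` steps `F` would drop by at least
  -- `N η > 1`, although it takes values in `[0, 1]`.
  obtain ⟨N, hN⟩ := exists_nat_gt (1 / η)
  rw [div_lt_iff₀ hη] at hN
  let x : ℕ → ℚ := fun k => s + (t - s) * (k / (N + 1))
  have hx : ∀ k, x k < x (k + 1) := fun k => by
    simp only [x]
    have := sub_pos.2 hst
    gcongr
    simp
  have hxs : ∀ k, s ≤ x k := fun k =>
    le_add_of_nonneg_right (mul_nonneg (sub_pos.2 hst).le (by positivity))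
  have hxt : ∀ k < N + 1, x k < t := fun k hk => by
    have h1 : (k : ℚ) / (N + 1) < 1 := by
      rw [div_lt_one (by positivity)]
      exact_mod_cast hk
    have := mul_lt_mul_of_pos_left h1 (sub_pos.2 hst)
    simp only [x]
    linarith
  by_contra! hc
  have h1 : ∑ k ∈ Finset.range N, η ≤ ∑ k ∈ Finset.range N, (F (x k) - F (x (k + 1))) := by
    refine Finset.sum_le_sum fun k hk => ?_
    have h2 := hc (x (k + 1)) (hxs _) (hxt _ (by simpa using hk))
    have h3 := h.le_add _ _ (hx k)
    linarith
  rw [Finset.sum_range_sub', Finset.sum_const, Finset.card_range, nsmul_eq_mul] at h1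
  linarith [h.F_le_one (x 0), h.F_nonneg (x N)]

/-- Partitions of small mesh all of whose points have small mass. -/
theorem exists_partition (hb : 0 < b) {n : ℕ} (hn : n ≠ 0) {η : ℝ} (hη : 0 < η) :
    ∃ P : RatPartition b, P.n = n ∧ (∀ i : Fin (P.n + 1), (i : ℕ) ≠ 0 → 1 - F (P.s i) - G (P.s i) ≤ η) ∧
      ∀ i : Fin P.n, P.s i.succ ≤ P.s i.castSucc + 2 * (b / n) := by
  have hn' : (0 : ℚ) < n := by positivity
  have hδ : 0 < b / n := div_pos hb hn'
  -- Taking the `i`-th point in `[i b/n, (i + 1) b/n)` gives both strict monotonicity and mesh at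
  -- most `2 b/n`. The endpoint 0 is prescribed and may carry large mass.
  have key : ∀ i : ℕ, ∃ t, i * (b / n) ≤ t ∧ t < (i + 1) * (b / n) ∧ (i = 0 → t = 0) ∧
      (i = n → t = b) ∧ (i ≠ 0 → 1 - F t - G t ≤ η) := by
    intro i
    rcases eq_or_ne i 0 with rfl | hi0
    · exact ⟨0, by simp, by simpa using hδ, fun _ => rfl, fun hi => absurd hi.symm hn,
        fun hi => absurd rfl hi⟩
    rcases eq_or_ne i n with rfl | hin
    · refine ⟨b, by rw [mul_div_cancel₀ _ hn'.ne'], ?_, fun hi => absurd hi hi0, fun _ => rfl,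
        fun _ => ?_⟩
      · rw [add_mul, mul_div_cancel₀ _ hn'.ne', one_mul]
        linarith
      · rw [h.F_last, h.G_last]
        linarith
    · obtain ⟨t, h1, h2, h3⟩ := h.exists_small_gap
        (show (i : ℚ) * (b / n) < (i + 1) * (b / n) by linarith) hη
      exact ⟨t, h1, h2, fun hi => absurd hi hi0, fun hi => absurd hi hin, fun _ => h3⟩
  choose σ hσ1 hσ2 hσ0 hσn hση using key
  have hmono : StrictMono σ := strictMono_nat_of_lt_succ fun i =>
    (hσ2 i).trans_le (by simpa using hσ1 (i + 1))
  refine ⟨⟨n, fun i => σ i, fun i j hij => hmono hij, hσ0 0 rfl, hσn n rfl⟩, rfl,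
    fun i hi => hση _ hi, fun i => ?_⟩
  have h1 := hσ1 i
  have h2 := hσ2 (i + 1)
  simp only [Fin.val_succ, Fin.val_castSucc]
  push_cast at h2
  linarith

theorem exists_sums_near (hb : 0 < b) (hG : G 0 = 0) {ε : ℝ} (hε : 0 < ε) :
    ∃ P : RatPartition b,
      H 0 - ε < ∑ i : Fin P.n,
        (P.s i.castSucc : ℝ) * (F (P.s i.castSucc) + G (P.s i.succ) - 1) ∧
      ∑ i : Fin P.n, (P.s i.succ : ℝ) * (1 - (G (P.s i.castSucc) + F (P.s i.succ))) <
        H 0 + ε := by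
  have hb' : (0 : ℝ) < b := by exact_mod_cast hb
  -- With `δ = b / n` the errors are `2δ` from the mesh, `δ` from the masses of the points and, in
  -- the upper sum only, `2δ` from the interval starting at 0.
  obtain ⟨n, hn⟩ := exists_nat_gt (5 * b / ε)
  rw [div_lt_iff₀ hε] at hn
  have hn0 : n ≠ 0 := by
    rintro rfl
    simp only [Nat.cast_zero, zero_mul] at hn
    linarith
  have hnR : (0 : ℝ) < n := by positivity
  -- Mass at most `1 / n²` per point costs at most `b / n² = δ / n` per term, hence `δ` over the `n`
  -- terms.
  obtain ⟨P, hPn, hgap, hmesh⟩ := h.exists_partition hb hn0 (η := 1 / (n * n)) (by positivity)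
  set δ : ℝ := b / n with hδ
  have hδ0 : 0 < δ := div_pos hb' hnR
  have hδε : 5 * δ < ε := by
    rw [hδ, mul_div_assoc', div_lt_iff₀ hnR]
    linarith
  have hmesh' : ∀ i : Fin P.n, (P.s i.succ : ℝ) ≤ P.s i.castSucc + 2 * δ := fun i => by
    have := hmesh i
    rw [hδ]
    exact_mod_cast this
  have hbη : ∀ (i : Fin (P.n + 1)) {g : ℝ}, g ≤ 1 / (n * n) → (P.s i : ℝ) * g ≤ δ / n := by
    intro i g hg
    have h0 : (0 : ℝ) ≤ P.s i := by exact_mod_cast P.nonneg i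
    have h1 : (P.s i : ℝ) ≤ b := by exact_mod_cast P.le_last i
    calc (P.s i : ℝ) * g ≤ P.s i * (1 / (n * n)) := mul_le_mul_of_nonneg_left hg h0
      _ ≤ b * (1 / (n * n)) := mul_le_mul_of_nonneg_right h1 (by positivity)
      _ = δ / n := by rw [hδ]; field_simp
  have hF : ∑ i : Fin P.n, (F (P.s i.castSucc) - F (P.s i.succ)) ≤ 1 := by
    rw [sum_fin_sub fun i => F (P.s i), P.first, P.last, h.F_last, sub_zero]
    exact h.F_le_one 0
  have hconst : ∑ _i : Fin P.n, δ / n = δ := by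
    rw [Finset.sum_const, Finset.card_univ, Fintype.card_fin, hPn, nsmul_eq_mul]
    field_simp
  have hterm : ∀ i : Fin P.n, H (P.s i.castSucc) - H (P.s i.succ) ≤
      (P.s i.succ - P.s i.castSucc) * F (P.s i.castSucc) ∧
      (P.s i.succ - P.s i.castSucc) * F (P.s i.succ) ≤ H (P.s i.castSucc) - H (P.s i.succ) ∧
      (P.s i.succ - P.s i.castSucc : ℝ) * (F (P.s i.castSucc) - F (P.s i.succ)) ≤
        2 * δ * (F (P.s i.castSucc) - F (P.s i.succ)) := fun i =>
    ⟨h.sub_le _ _ (P.lt_succ i), h.le_sub _ _ (P.lt_succ i), mul_le_mul_of_nonneg_right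
      (by linarith [hmesh' i]) (sub_nonneg.2 (h.F_anti (P.lt_succ i).le))⟩
  refine ⟨P, ?_, ?_⟩
  · have hle : ∑ i : Fin P.n, (((P.s i.castSucc * F (P.s i.castSucc) + H (P.s i.castSucc)) -
        (P.s i.succ * F (P.s i.succ) + H (P.s i.succ))) -
        2 * δ * (F (P.s i.castSucc) - F (P.s i.succ)) - δ / n) ≤ ∑ i : Fin P.n,
        (P.s i.castSucc : ℝ) * (F (P.s i.castSucc) + G (P.s i.succ) - 1) := by
      refine Finset.sum_le_sum fun i _ => ?_
      obtain ⟨h1, h2, h3⟩ := hterm i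
      have h4 := hbη i.castSucc (hgap i.succ (by simp))
      nlinarith
    rw [Finset.sum_sub_distrib, Finset.sum_sub_distrib, h.sum_sub P, hconst, ← Finset.mul_sum] at hle
    nlinarith
  · have hle : ∑ i : Fin P.n, (P.s i.succ : ℝ) * (1 - (G (P.s i.castSucc) + F (P.s i.succ))) ≤
        ∑ i : Fin P.n, (((P.s i.castSucc * F (P.s i.castSucc) + H (P.s i.castSucc)) -
        (P.s i.succ * F (P.s i.succ) + H (P.s i.succ))) +
        2 * δ * (F (P.s i.castSucc) - F (P.s i.succ)) +
        (δ / n + if (i : ℕ) = 0 then 2 * δ else 0)) := by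
      refine Finset.sum_le_sum fun i _ => ?_
      obtain ⟨h1, h2, h3⟩ := hterm i
      have h4 : (P.s i.succ : ℝ) * (1 - F (P.s i.castSucc) - G (P.s i.castSucc)) ≤
          δ / n + if (i : ℕ) = 0 then 2 * δ else 0 := by
        -- On the first interval the mass at 0 is uncontrolled, but its weight `s_1` is at most
        -- `2δ`.
        split_ifs with hi
        · have hi' : i.castSucc = 0 := Fin.ext hi
          have h5 := hmesh' i
          have h6 : (0 : ℝ) ≤ P.s i.succ := by exact_mod_cast P.nonneg _
          rw [hi', P.first] at h5 ⊢
          rw [hG]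
          have h7 : (0 : ℝ) < δ / n := by positivity
          simp only [Rat.cast_zero] at h5
          nlinarith [h.F_nonneg 0]
        · rw [add_zero]
          exact hbη i.succ (hgap i.castSucc hi)
      nlinarith
    have hite : ∑ i : Fin P.n, (if (i : ℕ) = 0 then 2 * δ else 0) ≤ 2 * δ := by
      have hPn0 : 0 < P.n := by omega
      rw [Finset.sum_eq_single (⟨0, hPn0⟩ : Fin P.n)]
      · simp
      · intro j _ hj
        rw [if_neg fun hj0 => hj (Fin.ext hj0)]
      · simp
    rw [Finset.sum_add_distrib, Finset.sum_add_distrib, Finset.sum_add_distrib, h.sum_sub P, hconst,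
      ← Finset.mul_sum] at hle
    nlinarith

end IsDistribution

/-! ### Evaluation of the Stieltjes formulas at a valuation -/

namespace IsValuation

variable {m : Spec e → ℝ} (hm : IsValuation e m)

include hm

theorem above_add_below_le (he : IsStrongUnit e) (f : R) (t : ℚ) :
    m (above e f t) + m (below e f t) ≤ 1 := by
  rw [hm.modular, above, below, Spec.D_sub_unit_inf he f le_rfl, hm.bot, add_zero]
  exact hm.le_one _

theorem le_above_add_below (f : R) {s t : ℚ} (h : s < t) :
    1 ≤ m (above e f s) + m (below e f t) := by
  rw [hm.modular, above, below, Spec.D_sub_unit_sup f h, hm.top]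
  linarith [hm.nonneg (Spec.D e (f - s • e) ⊓ Spec.D e (t • e - f))]

/-- For `s < t` the opens `(s < f)` and `(f < t)` cover the spectrum, so the modular law expresses
`Δ_f (s, t)` through the distribution functions. -/
theorem above_inf_below (f : R) {s t : ℚ} (h : s < t) :
    m (above e f s ⊓ below e f t) = m (above e f s) + m (below e f t) - 1 := by
  rw [hm.modular, above, below, Spec.D_sub_unit_sup f h, hm.top]
  ring

theorem above_anti (he : IsStrongUnit e) (f : R) : Antitone fun t => m (above e f t) :=
  fun _ _ h => hm.mono (Spec.D_sub_smul_anti he f h)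

theorem below_eq_one {f : R} {b : ℚ} (hf : StrictlyBelow e f b) : m (below e f b) = 1 := by
  obtain ⟨c, hcb, hc⟩ := hf
  refine le_antisymm (hm.le_one _) ?_
  rw [← hm.top, ← Spec.D_smul_unit (sub_pos.2 hcb), sub_smul]
  exact hm.mono (Spec.D_mono (sub_le_sub_left hc _))

theorem above_eq_zero (he : IsStrongUnit e) {f : R} {b : ℚ} (hf : StrictlyBelow e f b) :
    m (above e f b) = 0 := by
  have h1 := hm.above_add_below_le he f b
  rw [hm.below_eq_one hf] at h1
  linarith [hm.nonneg (above e f b)]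

theorem sat_lowerSumGt (f : R) {b : ℚ} (P : RatPartition b) (p : ℚ) :
    Sat (fun t : ℚ × Spec e => (t.1 : ℝ) < m t.2) (lowerSumGt e f P p) ↔
      (p : ℝ) < ∑ i : Fin P.n, (P.s i.castSucc : ℝ) *
        (m (above e f (P.s i.castSucc)) + m (below e f (P.s i.succ)) - 1) := by
  have hrw : ∀ i : Fin P.n, m (above e f (P.s i.castSucc)) + m (below e f (P.s i.succ)) - 1 =
      m (above e f (P.s i.castSucc) ⊓ below e f (P.s i.succ)) := fun i =>
    (hm.above_inf_below f (P.lt_succ i)).symm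
  simp only [hrw]
  constructor
  · intro h
    obtain ⟨⟨r, hr⟩, h⟩ := sat_any.1 h
    have h' := sat_all.1 h
    have hr' : (p : ℝ) < ∑ i, (P.s i.castSucc : ℝ) * r i := by exact_mod_cast hr
    refine hr'.trans_le (Finset.sum_le_sum fun i _ => mul_le_mul_of_nonneg_left ?_ ?_)
    · exact le_of_lt (h' i)
    · exact_mod_cast P.nonneg _
  · intro h
    obtain ⟨r, hr, hp⟩ := exists_rat_lt_sum (fun i => P.nonneg _) h
    exact sat_any.2 ⟨⟨r, by exact_mod_cast hp⟩, sat_all.2 hr⟩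

omit hm in
theorem sat_upperSumLt (f : R) {b : ℚ} (P : RatPartition b) (q : ℚ) :
    Sat (fun t : ℚ × Spec e => (t.1 : ℝ) < m t.2) (upperSumLt e f P q) ↔
      ∑ i : Fin P.n, (P.s i.succ : ℝ) *
        (1 - (m (below e f (P.s i.castSucc)) + m (above e f (P.s i.succ)))) < (q : ℝ) := by
  constructor
  · intro h
    obtain ⟨⟨r, hr⟩, h⟩ := sat_any.1 h
    have h' := sat_all.1 h
    have hr' : ∑ i, (P.s i.succ : ℝ) * r i < (q : ℝ) := by exact_mod_cast hr
    refine lt_of_le_of_lt (Finset.sum_le_sum fun i _ => mul_le_mul_of_nonneg_left ?_ ?_) hr'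
    · have := sat_valAddGt.1 (h' i)
      push_cast at this
      linarith
    · exact_mod_cast P.nonneg _
  · intro h
    obtain ⟨r, hr, hp⟩ := exists_rat_sum_lt (fun i => P.nonneg _) h
    refine sat_any.2 ⟨⟨r, by exact_mod_cast hp⟩, sat_all.2 fun i => sat_valAddGt.2 ?_⟩
    have := hr i
    push_cast
    linarith

end IsValuation

/-! ### The Stieltjes sums of `intVal I` recover `I` -/

namespace IsIntegral

variable {I : R →+ ℝ} (hI : IsIntegral e I)

include hI

theorem isDistribution (he : IsStrongUnit e) {f : R} {b : ℚ} (hb : StrictlyBelow e f b) :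
    IsDistribution b (fun t => intVal I (above e f t)) (fun t => intVal I (below e f t))
      fun t => I (f - t • e)⁺ where
  F_anti := (hI.isValuation_intVal he).above_anti he f
  F_nonneg _ := (hI.isValuation_intVal he).nonneg _
  F_le_one _ := (hI.isValuation_intVal he).le_one _
  add_le t := (hI.isValuation_intVal he).above_add_below_le he f t
  le_add _ _ h := (hI.isValuation_intVal he).le_above_add_below f h
  le_sub _ _ h := hI.mul_intVal_above_le he f h
  sub_le _ _ h := hI.le_mul_intVal_above he f h
  F_last := (hI.isValuation_intVal he).above_eq_zero he hb
  G_last := (hI.isValuation_intVal he).below_eq_one hb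
  H_last := by
    obtain ⟨c, hcb, hc⟩ := hb
    rw [posPart_eq_zero.2 (sub_nonpos.2 (hc.trans (he.smul_le_smul hcb.le))), map_zero]

theorem zero_lt_of_strictlyBelow {f : R} (hf : 0 ≤ f) {b : ℚ} (hb : StrictlyBelow e f b) :
    0 < b := by
  obtain ⟨c, hcb, hc⟩ := hb
  have h1 := hI.mono (hf.trans hc)
  rw [map_zero, hI.smul_unit] at h1
  exact lt_of_le_of_lt (by exact_mod_cast h1) hcb

theorem exists_sums_near (he : IsStrongUnit e) {f : R} (hf : 0 ≤ f) {b : ℚ}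
    (hb : StrictlyBelow e f b) {ε : ℝ} (hε : 0 < ε) :
    ∃ P : RatPartition b,
      I f - ε < ∑ i : Fin P.n, (P.s i.castSucc : ℝ) *
        (intVal I (above e f (P.s i.castSucc)) + intVal I (below e f (P.s i.succ)) - 1) ∧
      ∑ i : Fin P.n, (P.s i.succ : ℝ) *
        (1 - (intVal I (below e f (P.s i.castSucc)) + intVal I (above e f (P.s i.succ)))) <
        I f + ε := by
  have h0 : intVal I (below e f 0) = 0 := by
    rw [below, Spec.D_of_nonpos (by simpa using hf), (hI.isValuation_intVal he).bot]
  have h := (hI.isDistribution he hb).exists_sums_near (hI.zero_lt_of_strictlyBelow hf hb) h0 hε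
  simpa only [zero_smul, sub_zero, posPart_of_nonneg hf] using h

theorem sat_stieltjesGt (he : IsStrongUnit e) {f : R} (hf : 0 ≤ f) {b : ℚ}
    (hb : StrictlyBelow e f b) (p : ℚ) :
    Sat (fun t : ℚ × Spec e => (t.1 : ℝ) < intVal I t.2) (stieltjesGt e f b p) ↔
      (p : ℝ) < I f := by
  have hle := (hI.isDistribution he hb).lowerSum_le
  simp only [zero_smul, sub_zero, posPart_of_nonneg hf] at hle
  refine sat_any.trans ⟨fun ⟨P, hP⟩ => ?_, fun h => ?_⟩
  · exact (((hI.isValuation_intVal he).sat_lowerSumGt f P p).1 hP).trans_le (hle P)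
  · obtain ⟨P, hP, -⟩ := hI.exists_sums_near he hf hb (sub_pos.2 h)
    rw [sub_sub_cancel] at hP
    exact ⟨P, ((hI.isValuation_intVal he).sat_lowerSumGt f P p).2 hP⟩

theorem sat_stieltjesLt (he : IsStrongUnit e) {f : R} (hf : 0 ≤ f) {b : ℚ}
    (hb : StrictlyBelow e f b) (q : ℚ) :
    Sat (fun t : ℚ × Spec e => (t.1 : ℝ) < intVal I t.2) (stieltjesLt e f b q) ↔
      I f < (q : ℝ) := by
  have hle := (hI.isDistribution he hb).le_upperSum
  simp only [zero_smul, sub_zero, posPart_of_nonneg hf] at hle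
  refine sat_any.trans ⟨fun ⟨P, hP⟩ => ?_, fun h => ?_⟩
  · exact (hle P).trans_lt ((IsValuation.sat_upperSumLt f P q).1 hP)
  · obtain ⟨P, -, hP⟩ := hI.exists_sums_near he hf hb (sub_pos.2 h)
    rw [add_sub_cancel] at hP
    exact ⟨P, (IsValuation.sat_upperSumLt f P q).2 hP⟩

theorem sat_stieltjesPos (he : IsStrongUnit e) {f : R} {b c : ℚ}
    (hb : StrictlyBelow e f⁺ b) (hc : StrictlyBelow e f⁻ c) :
    Sat (fun t : ℚ × Spec e => (t.1 : ℝ) < intVal I t.2) (stieltjesPos e f b c) ↔ 0 < I f := by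
  have hf : I f = I f⁺ - I f⁻ := by rw [← map_sub, posPart_sub_negPart]
  refine sat_any.trans ⟨fun ⟨q, hq⟩ => ?_, fun h => ?_⟩
  · have h1 := (hI.sat_stieltjesGt he (posPart_nonneg f) hb q).1 hq.1
    have h2 := (hI.sat_stieltjesLt he (negPart_nonneg f) hc q).1 hq.2
    linarith
  · obtain ⟨q, h1, h2⟩ := exists_rat_btwn (show I f⁻ < I f⁺ by linarith)
    exact ⟨q, (hI.sat_stieltjesGt he (posPart_nonneg f) hb q).2 h2,
      (hI.sat_stieltjesLt he (negPart_nonneg f) hc q).2 h1⟩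

end IsIntegral

/-! ### From valuations to integrals -/

/-- If `z l` are the level sets of an integer-valued function `f`, these are the level sets of
`f + 1_y`. -/
def bump {L : Type*} [Lattice L] (y : L) (z : ℕ → L) : ℕ → L
  | 0 => z 0
  | l + 1 => z (l + 1) ⊔ (z l ⊓ y)

theorem antitone_bump {L : Type*} [Lattice L] (y : L) {z : ℕ → L} (hz : Antitone z) :
    Antitone (bump y z) := by
  refine antitone_nat_of_succ_le fun l => ?_
  cases l with
  | zero => exact sup_le (hz (Nat.zero_le 1)) inf_le_left
  | succ l => exact (sup_le (hz (Nat.le_succ _)) inf_le_left).trans le_sup_left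

/-- The level sets of the integer-valued approximation to `f + (g ∧ jδ)`. -/
def levels (e f g : R) (δ : ℚ) : ℕ → ℕ → Spec e
  | 0, 0 => ⊤
  | 0, l + 1 => Spec.D e (f - (l * δ) • e)
  | j + 1, l => bump (Spec.D e (g - (j * δ) • e)) (levels e f g δ j) l

theorem levels_succ (f g : R) (δ : ℚ) (j : ℕ) :
    levels e f g δ (j + 1) = bump (Spec.D e (g - (j * δ) • e)) (levels e f g δ j) := by
  funext l; rw [levels]

theorem levels_zero_right (f g : R) (δ : ℚ) (j : ℕ) : levels e f g δ j 0 = ⊤ := by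
  induction j with
  | zero => rw [levels]
  | succ j ih => rw [levels_succ, bump, ih]

theorem antitone_levels (he : IsStrongUnit e) (f g : R) {δ : ℚ} (hδ : 0 < δ) (j : ℕ) :
    Antitone (levels e f g δ j) := by
  induction j with
  | zero =>
    refine antitone_nat_of_succ_le fun l => ?_
    cases l with
    | zero => rw [levels_zero_right]; exact le_top
    | succ l =>
      rw [levels, levels]
      exact Spec.D_sub_smul_anti he f (mul_le_mul_of_nonneg_right (by simp) hδ.le)
  | succ j ih => rw [levels_succ]; exact antitone_bump _ ih

/-- A point-free form of `⌈(f + g)/δ⌉ ≤ ⌈f/δ⌉ + ⌈g/δ⌉`, adding `g` in slices of height `δ`. By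
distributivity a bumped level is `(z (l+1) ⊔ z l) ⊓ (z (l+1) ⊔ y)`. With `c = jδ`, the first factor
uses `g ∧ (c + δ) ≤ g ∧ c + δ`, the second `g = g ∧ c + (g - c)⁺`. -/
theorem D_le_levels (he : IsStrongUnit e) (f g : R) (hg : 0 ≤ g) {δ : ℚ} (hδ : 0 < δ) (j l : ℕ) :
    Spec.D e (f + g ⊓ (j * δ) • e - (l * δ) • e) ≤ levels e f g δ j (l + 1) := by
  induction j generalizing l with
  | zero =>
    rw [levels, Nat.cast_zero, zero_mul, zero_smul, inf_eq_right.2 hg, add_zero]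
  | succ j ih =>
    rw [levels_succ, bump, sup_inf_left]
    set c := (j * δ) • e with hc
    have hc' : ((j + 1 : ℕ) * δ) • e = c + δ • e := by
      rw [hc, ← add_smul]; congr 1; push_cast; ring
    rw [hc']
    refine le_inf ?_ ?_
    · refine le_trans ?_ le_sup_right
      cases l with
      | zero => rw [levels_zero_right]; exact le_top
      | succ l =>
        refine le_trans (Spec.D_mono ?_) (ih l)
        have h1 : g ⊓ (c + δ • e) ≤ g ⊓ c + δ • e := by
          rw [inf_add]
          exact inf_le_inf_right _ (le_add_of_nonneg_right (smul_nonneg hδ.le he.nonneg))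
        have h2 : ((l + 1 : ℕ) * δ) • e = (l * δ) • e + δ • e := by
          rw [← add_smul]; congr 1; push_cast; ring
        rw [h2]
        calc f + g ⊓ (c + δ • e) - ((l * δ) • e + δ • e)
            ≤ f + (g ⊓ c + δ • e) - ((l * δ) • e + δ • e) :=
              sub_le_sub_right (add_le_add_right h1 f) _
          _ = f + g ⊓ c - (l * δ) • e := by abel
    · refine le_trans ?_ (sup_le_sup_right (ih l) _)
      rw [← Spec.D_posPart (g - c)]
      refine le_trans (Spec.D_mono ?_) (Spec.D_add_le _ _)
      have h1 : g = g ⊓ c + (g - c)⁺ := by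
        rw [inf_eq_sub_posPart_sub, sub_add_cancel]
      calc f + g ⊓ (c + δ • e) - (l * δ) • e ≤ f + g - (l * δ) • e :=
            sub_le_sub_right (add_le_add_right inf_le_left f) _
        _ = f + g ⊓ c - (l * δ) • e + (g - c)⁺ := by
            nth_rw 1 [h1]
            abel

/-- Unnormalized Riemann sums `∑_{l < M} μ (lδ < f)`. -/
noncomputable def levelSum (m : Spec e → ℝ) (δ : ℚ) (M : ℕ) (f : R) : ℝ :=
  ∑ l ∈ Finset.range M, m (Spec.D e (f - (l * δ) • e))

/-! ### Subadditivity and complementation of level sums -/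

namespace IsValuation

variable {m : Spec e → ℝ} (hm : IsValuation e m)

include hm

/-- By the modular law each level gains `m (z l ⊓ y) - m (z (l+1) ⊓ y)`, and these gains telescope
to at most `m y`. -/
theorem sum_bump_le (y : Spec e) {z : ℕ → Spec e} (hz : Antitone z) (M : ℕ) :
    ∑ l ∈ Finset.range M, m (bump y z (l + 1)) ≤ ∑ l ∈ Finset.range M, m (z (l + 1)) + m y := by
  have h1 : ∀ l, m (bump y z (l + 1)) = m (z (l + 1)) + (m (z l ⊓ y) - m (z (l + 1) ⊓ y)) := by
    intro l
    have h2 := hm.modular (z (l + 1)) (z l ⊓ y)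
    rw [← inf_assoc, inf_eq_left.2 (hz (Nat.le_succ l))] at h2
    rw [bump]
    linarith
  simp only [h1]
  rw [Finset.sum_add_distrib, Finset.sum_range_sub' fun l => m (z l ⊓ y)]
  linarith [hm.mono (inf_le_right : z 0 ⊓ y ≤ y), hm.nonneg (z M ⊓ y)]

theorem sum_levels_le (he : IsStrongUnit e) (f g : R) {δ : ℚ} (hδ : 0 < δ) (M j : ℕ) :
    ∑ l ∈ Finset.range M, m (levels e f g δ j (l + 1)) ≤ levelSum m δ M f + levelSum m δ j g := by
  induction j with
  | zero => simp [levels, levelSum]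
  | succ j ih =>
    rw [levels_succ]
    refine (hm.sum_bump_le _ (antitone_levels he f g hδ j) M).trans ?_
    rw [levelSum, levelSum, Finset.sum_range_succ]
    rw [levelSum, levelSum] at ih
    linarith

/-- Riemann sums are subadditive. -/
theorem levelSum_add_le (he : IsStrongUnit e) (f : R) {g : R} (hg : 0 ≤ g) {δ : ℚ} (hδ : 0 < δ)
    (M : ℕ) {j : ℕ} (hj : g ≤ (j * δ) • e) :
    levelSum m δ M (f + g) ≤ levelSum m δ M f + levelSum m δ j g := by
  refine le_trans (Finset.sum_le_sum fun l _ => hm.mono ?_) (hm.sum_levels_le he f g hδ M j)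
  have := D_le_levels he f g hg hδ j l
  rwa [inf_eq_left.2 hj] at this

theorem levelSum_nonneg (δ : ℚ) (M : ℕ) (f : R) : 0 ≤ levelSum m δ M f :=
  Finset.sum_nonneg fun _ _ => hm.nonneg _

theorem levelSum_le (δ : ℚ) (M : ℕ) (f : R) : levelSum m δ M f ≤ M := by
  refine (Finset.sum_le_sum fun _ _ => hm.le_one _).trans ?_
  simp

theorem levelSum_congr (he : IsStrongUnit e) {δ : ℚ} (hδ : 0 < δ) {L M : ℕ} (hLM : L ≤ M) {f : R}
    (hf : f ≤ (L * δ) • e) : levelSum m δ L f = levelSum m δ M f := by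
  refine Finset.sum_subset (Finset.range_mono hLM) fun l _ hl => ?_
  have hl' : L ≤ l := by simpa using hl
  rw [Spec.D_of_nonpos, hm.bot]
  refine sub_nonpos.2 (hf.trans (he.smul_le_smul (mul_le_mul_of_nonneg_right ?_ hδ.le)))
  exact_mod_cast hl'

/-- Riemann sums of `f` and `Mδ - f` add up to `M`, up to `1`. -/
theorem levelSum_add_levelSum_sub_le (he : IsStrongUnit e) (f : R) (δ : ℚ) (M : ℕ) :
    levelSum m δ M f + levelSum m δ M ((M * δ) • e - f) ≤ M + 1 := by
  -- Reversing the order of summation, `l ↦ M - 1 - l`, gives the masses of `(f < (l + 1) δ)`.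
  have h1 : levelSum m δ M ((M * δ) • e - f) =
      ∑ l ∈ Finset.range M, m (Spec.D e (((l + 1 : ℕ) * δ) • e - f)) := by
    rw [levelSum, ← Finset.sum_range_reflect]
    refine Finset.sum_congr rfl fun l hl => ?_
    have hl' : l + 1 ≤ M := by simpa using hl
    congr 2
    rw [sub_right_comm, ← sub_smul, ← sub_mul]
    congr 3
    rw [← Nat.cast_sub (by omega)]
    congr 1
    omega
  -- Shifting the index to match costs at most `m (D f) ≤ 1`, the error term of the statement.
  have h2 : levelSum m δ M f + m (Spec.D e (f - (M * δ) • e)) =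
      ∑ l ∈ Finset.range M, m (Spec.D e (f - ((l + 1 : ℕ) * δ) • e)) +
        m (Spec.D e (f - ((0 : ℕ) * δ) • e)) := by
    rw [levelSum, ← Finset.sum_range_succ (fun l : ℕ => m (Spec.D e (f - (l * δ) • e))),
      Finset.sum_range_succ' (fun l : ℕ => m (Spec.D e (f - (l * δ) • e)))]
  have h3 : ∑ l ∈ Finset.range M, m (Spec.D e (f - ((l + 1 : ℕ) * δ) • e)) +
      ∑ l ∈ Finset.range M, m (Spec.D e (((l + 1 : ℕ) * δ) • e - f)) ≤ M := by
    rw [← Finset.sum_add_distrib]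
    refine (Finset.sum_le_sum fun l _ => hm.above_add_below_le he f _).trans ?_
    simp
  have h4 := hm.le_one (Spec.D e (f - ((0 : ℕ) * δ) • e))
  have h5 := hm.nonneg (Spec.D e (f - (M * δ) • e))
  linarith

theorem levelSum_smul_unit {δ : ℚ} (hδ : 0 < δ) (M : ℕ) :
    levelSum m δ M ((M * δ) • e) = M := by
  have : ∀ l ∈ Finset.range M, m (Spec.D e ((M * δ) • e - (l * δ) • e)) = 1 := fun l hl => by
    have hl' : (l : ℚ) < M := by exact_mod_cast Finset.mem_range.1 hl
    rw [← sub_smul, ← sub_mul, Spec.D_smul_unit (mul_pos (sub_pos.2 hl') hδ), hm.top]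
  rw [levelSum, Finset.sum_congr rfl this]
  simp

end IsValuation

/-- Normalized Riemann sums of mesh `1 / (N + 1)` over `[0, N + 1]`. -/
noncomputable def riemannSum (m : Spec e → ℝ) (N : ℕ) (f : R) : ℝ :=
  levelSum m (1 / ((N : ℚ) + 1)) ((N + 1) * (N + 1)) f / (N + 1)

/-! ### The integral as an ultrafilter limit of Riemann sums -/

namespace IsValuation

variable {m : Spec e → ℝ} (hm : IsValuation e m)

include hm

theorem riemannSum_eq (he : IsStrongUnit e) {f : R} {c N : ℕ} (hf : f ≤ (c : ℚ) • e)
    (hcN : c ≤ N + 1) :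
    riemannSum m N f = levelSum m (1 / ((N : ℚ) + 1)) (c * (N + 1)) f / (N + 1) := by
  rw [riemannSum, hm.levelSum_congr he (by positivity) (Nat.mul_le_mul_right (N + 1) hcN)]
  refine hf.trans_eq ?_
  congr 1
  push_cast
  field_simp

theorem riemannSum_nonneg (f : R) (N : ℕ) : 0 ≤ riemannSum m N f :=
  div_nonneg (hm.levelSum_nonneg _ _ f) (by positivity)

theorem riemannSum_le (he : IsStrongUnit e) {f : R} {c N : ℕ} (hf : f ≤ (c : ℚ) • e)
    (hcN : c ≤ N + 1) : riemannSum m N f ≤ c := by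
  rw [hm.riemannSum_eq he hf hcN, div_le_iff₀ (by positivity)]
  exact_mod_cast hm.levelSum_le _ (c * (N + 1)) f

theorem riemannSum_add_le (he : IsStrongUnit e) (f : R) {g : R} (hg : 0 ≤ g) {c N : ℕ}
    (hgc : g ≤ (c : ℚ) • e) (hcN : c ≤ N + 1) :
    riemannSum m N (f + g) ≤ riemannSum m N f + riemannSum m N g := by
  rw [riemannSum, riemannSum, riemannSum, ← add_div]
  refine div_le_div_of_nonneg_right (hm.levelSum_add_le he f hg (by positivity) _ ?_)
    (by positivity)
  refine hgc.trans (he.smul_le_smul ?_)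
  push_cast
  rw [mul_one_div, mul_div_cancel_right₀ _ (by positivity)]
  exact_mod_cast hcN

omit hm in
theorem natCast_mul_eq (c N : ℕ) : ((c * (N + 1) : ℕ) : ℚ) * (1 / ((N : ℚ) + 1)) = c := by
  push_cast
  field_simp

theorem riemannSum_smul_unit (he : IsStrongUnit e) {c N : ℕ} (hcN : c ≤ N + 1) :
    riemannSum m N ((c : ℚ) • e) = c := by
  have h := hm.levelSum_smul_unit (show (0 : ℚ) < 1 / ((N : ℚ) + 1) by positivity) (c * (N + 1))
  rw [natCast_mul_eq] at h
  rw [hm.riemannSum_eq he le_rfl hcN, h, div_eq_iff (by positivity)]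
  push_cast
  ring

theorem riemannSum_add_sub_le (he : IsStrongUnit e) {f : R} (hf : 0 ≤ f) {c N : ℕ}
    (hfc : f ≤ (c : ℚ) • e) (hcN : c ≤ N + 1) :
    riemannSum m N f + riemannSum m N ((c : ℚ) • e - f) ≤ c + 1 / ((N : ℝ) + 1) := by
  have h := hm.levelSum_add_levelSum_sub_le he f (1 / ((N : ℚ) + 1)) (c * (N + 1))
  rw [natCast_mul_eq] at h
  rw [hm.riemannSum_eq he hfc hcN, hm.riemannSum_eq he (sub_le_self _ hf) hcN, ← add_div,
    div_le_iff₀ (by positivity), add_mul, one_div_mul_cancel (by positivity)]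
  exact_mod_cast h

/-- Limits of Riemann sums along a fixed ultrafilter. -/
theorem exists_tendsto_riemannSum (he : IsStrongUnit e) (f : R) :
    ∃ x : ℝ, Tendsto (fun N => riemannSum m N f) (hyperfilter ℕ) (𝓝 x) := by
  obtain ⟨n, -, hn⟩ := he f
  rw [← Nat.cast_smul_eq_nsmul ℚ] at hn
  -- The sums are eventually in a compact interval, so the ultrafilter limit exists without any
  -- convergence argument.
  have hmem : Set.Icc (0 : ℝ) n ∈ (hyperfilter ℕ).map fun N => riemannSum m N f := by
    refine Nat.hyperfilter_le_atTop ?_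
    filter_upwards [eventually_ge_atTop n] with N hN
    exact ⟨hm.riemannSum_nonneg f N, hm.riemannSum_le he hn (by omega)⟩
  obtain ⟨x, -, hx⟩ := isCompact_Icc.ultrafilter_le_nhds' _ hmem
  exact ⟨x, hx⟩

/-- Every valuation comes from an integral. -/
theorem exists_integral (he : IsStrongUnit e) :
    ∃ I : R →+ ℝ, IsIntegral e I ∧ intVal I = m := by
  choose J hJ using hm.exists_tendsto_riemannSum he
  have hlarge : ∀ c : ℕ, ∀ᶠ N in (hyperfilter ℕ : Filter ℕ), c ≤ N + 1 := fun c =>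
    Nat.hyperfilter_le_atTop ((eventually_ge_atTop c).mono fun N hN => by omega)
  have hunit : ∀ f : R, ∃ c : ℕ, f ≤ (c : ℚ) • e := fun f => by
    obtain ⟨n, -, hn⟩ := he f
    exact ⟨n, by rwa [Nat.cast_smul_eq_nsmul]⟩
  have hJnn : ∀ f, 0 ≤ J f := fun f =>
    ge_of_tendsto' (hJ f) fun N => hm.riemannSum_nonneg f N
  have hJc : ∀ c : ℕ, J ((c : ℚ) • e) = c := fun c =>
    tendsto_nhds_unique (hJ _) (tendsto_const_nhds.congr'
      ((hlarge c).mono fun N hN => (hm.riemannSum_smul_unit he hN).symm))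
  have hJadd_le : ∀ f g, 0 ≤ g → J (f + g) ≤ J f + J g := fun f g hg => by
    obtain ⟨c, hc⟩ := hunit g
    exact le_of_tendsto_of_tendsto (hJ _) ((hJ f).add (hJ g))
      ((hlarge c).mono fun N hN => hm.riemannSum_add_le he f hg hc hN)
  have hJsub : ∀ (f : R) (c : ℕ), 0 ≤ f → f ≤ (c : ℚ) • e → J f + J ((c : ℚ) • e - f) = c := by
    intro f c hf hfc
    apply le_antisymm
    · have h0 : Tendsto (fun N : ℕ => (c : ℝ) + 1 / ((N : ℝ) + 1)) (hyperfilter ℕ) (𝓝 (c + 0)) :=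
        (tendsto_one_div_add_atTop_nhds_zero_nat.mono_left Nat.hyperfilter_le_atTop).const_add _
      rw [add_zero] at h0
      exact le_of_tendsto_of_tendsto ((hJ _).add (hJ _)) h0
        ((hlarge c).mono fun N hN => hm.riemannSum_add_sub_le he hf hfc hN)
    · have h := hJadd_le ((c : ℚ) • e - f) f hf
      rw [sub_add_cancel, hJc] at h
      linarith
  have hJadd : ∀ f g, 0 ≤ f → 0 ≤ g → J (f + g) = J f + J g := by
    intro f g hf hg
    refine le_antisymm (hJadd_le f g hg) ?_
    obtain ⟨a, ha⟩ := hunit f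
    obtain ⟨b, hb⟩ := hunit g
    have hab : f + g ≤ ((a + b : ℕ) : ℚ) • e := by
      rw [Nat.cast_add, add_smul]
      exact add_le_add ha hb
    have h1 := hJsub _ _ (add_nonneg hf hg) hab
    have h2 := hJsub f a hf ha
    have h3 := hJsub g b hg hb
    -- Superadditivity at `f, g` is subadditivity at the complements `a e - f`, `b e - g`, converted
    -- by `hJsub`.
    have h4 := hJadd_le ((a : ℚ) • e - f) ((b : ℚ) • e - g) (sub_nonneg.2 hb)
    rw [show (a : ℚ) • e - f + ((b : ℚ) • e - g) = ((a + b : ℕ) : ℚ) • e - (f + g) by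
      rw [Nat.cast_add, add_smul]; abel] at h4
    push_cast at h1 h4
    linarith
  have hJ0 : J 0 = 0 := by simpa using hJc 0
  have hI : ∀ f g, J (f + g)⁺ - J (f + g)⁻ = (J f⁺ - J f⁻) + (J g⁺ - J g⁻) := by
    intro f g
    have h1 : (f + g)⁺ + (f⁻ + g⁻) = (f + g)⁻ + (f⁺ + g⁺) := by
      rw [add_comm (f + g)⁻, ← sub_eq_sub_iff_add_eq_add, posPart_sub_negPart, add_sub_add_comm, posPart_sub_negPart,
        posPart_sub_negPart]
    have h2 := congrArg J h1
    rw [hJadd _ _ (posPart_nonneg _) (add_nonneg (negPart_nonneg _) (negPart_nonneg _)),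
      hJadd _ _ (negPart_nonneg _) (add_nonneg (posPart_nonneg _) (posPart_nonneg _)),
      hJadd _ _ (negPart_nonneg _) (negPart_nonneg _),
      hJadd _ _ (posPart_nonneg _) (posPart_nonneg _)] at h2
    linarith
  obtain ⟨I, hIdef⟩ : ∃ I : R →+ ℝ, ∀ f, I f = J f⁺ - J f⁻ :=
    ⟨AddMonoidHom.mk' (fun f => J f⁺ - J f⁻) hI, fun _ => rfl⟩
  have hIJ : ∀ f, 0 ≤ f → I f = J f := fun f hf => by
    rw [hIdef, posPart_of_nonneg hf, negPart_eq_zero.2 hf, hJ0, sub_zero]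
  have hint : IsIntegral e I := by
    refine ⟨fun f hf => (hIJ f hf).symm ▸ hJnn f, ?_⟩
    have := hJc 1
    rw [Nat.cast_one, one_smul] at this
    rw [hIJ e he.nonneg, this, Nat.cast_one]
  refine ⟨I, hint, funext fun x => ?_⟩
  obtain ⟨a, rfl⟩ := Spec.exists_D_eq x
  have hnn : ∀ n : ℕ, 0 ≤ (n • a⁺) ⊓ e := fun n =>
    le_inf (nsmul_nonneg (posPart_nonneg a) n) he.nonneg
  have hle1 : ∀ n : ℕ, (n • a⁺) ⊓ e ≤ ((1 : ℕ) : ℚ) • e := fun n => by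
    rw [Nat.cast_one, one_smul]; exact inf_le_right
  rw [hint.intVal_D he]
  apply le_antisymm
  -- Every level of `n a⁺ ∧ e` lies inside `D a`, and the Riemann sum is an average of `N + 1`
  -- levels.
  · refine ciSup_le fun n => ?_
    rw [hIJ _ (hnn n)]
    refine le_of_tendsto (hJ _) ((hlarge 1).mono fun N hN => ?_)
    rw [hm.riemannSum_eq he (hle1 n) hN, div_le_iff₀ (by positivity)]
    refine (Finset.sum_le_card_nsmul _ _ (m (Spec.D e a)) fun l _ => hm.mono ?_).trans_eq ?_
    · refine le_trans (Spec.D_mono ?_) ((Spec.D_nsmul_le n a⁺).trans_eq (Spec.D_posPart a))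
      exact (sub_le_self _ (smul_nonneg (by positivity) he.nonneg)).trans inf_le_left
    · rw [Finset.card_range, nsmul_eq_mul]
      push_cast
      ring
  · refine le_of_forall_lt fun p hp => ?_
    obtain ⟨ε, hε, hpε⟩ := hm.scott a p hp
    -- Once `n ε ≥ 1`, the element `n a⁺ ∧ e` reaches `e` on `(ε < a)`, so all its levels below 1
    -- contain that open.
    obtain ⟨n, hn⟩ := exists_nat_ge (ε⁻¹)
    have hn0 : (0 : ℚ) < n := (inv_pos.2 hε).trans_le hn
    have hnε : 1 ≤ n * ε := (inv_le_iff_one_le_mul₀ hε).1 hn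
    refine lt_of_lt_of_le (hpε.trans_le ?_) (le_ciSup (hint.bddAbove_range a) n)
    rw [hIJ _ (hnn n)]
    refine ge_of_tendsto (hJ _) ((hlarge 1).mono fun N hN => ?_)
    rw [hm.riemannSum_eq he (hle1 n) hN, le_div_iff₀ (by positivity)]
    refine le_trans (le_of_eq ?_)
      (Finset.card_nsmul_le_sum _ _ (m (Spec.D e (a - ε • e))) fun l hl => hm.mono ?_)
    · rw [Finset.card_range, nsmul_eq_mul]
      push_cast
      ring
    · have hl' : (l : ℚ) * (1 / ((N : ℚ) + 1)) < 1 := by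
        rw [mul_one_div, div_lt_one (by positivity)]
        have : l < 1 * (N + 1) := Finset.mem_range.1 hl
        rw [one_mul] at this
        exact_mod_cast this
      rw [inf_sub, Spec.D_inf]
      refine le_inf ?_ ?_
      · rw [← Spec.D_smul hn0 (a - ε • e), smul_sub, smul_smul, Nat.cast_smul_eq_nsmul]
        exact Spec.D_mono (sub_le_sub (nsmul_le_nsmul_right (le_posPart a) n)
          (he.smul_le_smul (hl'.le.trans hnε)))
      · have h1 : e - ((l : ℚ) * (1 / ((N : ℚ) + 1))) • e =
            (1 - (l : ℚ) * (1 / ((N : ℚ) + 1))) • e := by rw [sub_smul, one_smul]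
        rw [h1, Spec.D_smul_unit (sub_pos.2 hl')]
        exact le_top

end IsValuation

/-! ### The two interpretations -/

theorem sat_supIntGt (he : IsStrongUnit e) {I : R →+ ℝ} (hI : IsIntegral e I) (a : R) (p : ℚ) :
    Sat (fun f : R => 0 < I f) (supIntGt e a p) ↔ (p : ℝ) < intVal I (Spec.D e a) := by
  rw [hI.intVal_D he]
  refine sat_any.trans ⟨fun ⟨n, hn⟩ => ?_, fun h => ?_⟩
  · replace hn : 0 < I ((n • a⁺) ⊓ e - p • e) := hn
    rw [hI.map_sub_smul_unit] at hn
    exact (sub_pos.1 hn).trans_le (le_ciSup (hI.bddAbove_range a) n)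
  · obtain ⟨n, hn⟩ := exists_lt_of_lt_ciSup h
    refine ⟨n, (?_ : 0 < I ((n • a⁺) ⊓ e - p • e))⟩
    rw [hI.map_sub_smul_unit]
    exact sub_pos.2 hn

/-- Entailment in the theory of integrals is truth for all integrals. -/
theorem entails_INT (he : IsStrongUnit e) {φ ψ : Formula R}
    (h : ∀ I : R →+ ℝ, IsIntegral e I → Sat (fun f => 0 < I f) φ → Sat (fun f => 0 < I f) ψ) :
    (INT e).Entails φ ψ := by
  refine entails_of_forall_sat (isCompactCompletelyRegular_INT he) fun v hv => ?_
  obtain ⟨I, hI, hvI⟩ := exists_integral_of_isModel he hv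
  obtain rfl : v = fun f : R => 0 < I f := funext fun f => propext (hvI f)
  exact h I hI

/-- Entailment in the theory of valuations is truth for the valuations of all integrals. -/
theorem entails_VAL (he : IsStrongUnit e) {φ ψ : Formula (ℚ × Spec e)}
    (h : ∀ I : R →+ ℝ, IsIntegral e I → Sat (fun t => (t.1 : ℝ) < intVal I t.2) φ →
      Sat (fun t => (t.1 : ℝ) < intVal I t.2) ψ) :
    (VAL e).Entails φ ψ := by
  refine entails_of_forall_sat (isCompactCompletelyRegular_VAL he) fun v hv => ?_
  obtain ⟨m, hm, hvm⟩ := exists_valuation_of_isModel hv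
  obtain rfl : v = fun t : ℚ × Spec e => (t.1 : ℝ) < m t.2 := funext fun t => propext (hvm t)
  obtain ⟨I, hI, rfl⟩ := hm.exists_integral he
  exact h I hI

theorem equivalent_INT (he : IsStrongUnit e) {φ ψ : Formula R}
    (h : ∀ I : R →+ ℝ, IsIntegral e I → (Sat (fun f => 0 < I f) φ ↔ Sat (fun f => 0 < I f) ψ)) :
    (INT e).Equivalent φ ψ :=
  ⟨entails_INT he fun I hI => (h I hI).1, entails_INT he fun I hI => (h I hI).2⟩

theorem equivalent_VAL (he : IsStrongUnit e) {φ ψ : Formula (ℚ × Spec e)}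
    (h : ∀ I : R →+ ℝ, IsIntegral e I → (Sat (fun t => (t.1 : ℝ) < intVal I t.2) φ ↔
      Sat (fun t => (t.1 : ℝ) < intVal I t.2) ψ)) :
    (VAL e).Equivalent φ ψ :=
  ⟨entails_VAL he fun I hI => (h I hI).1, entails_VAL he fun I hI => (h I hI).2⟩

/-- The formula `p < sup_n I (n a⁺ ∧ 1)`, where `x = D a`. -/
noncomputable def valToInt (e : R) (t : ℚ × Spec e) : Formula R := supIntGt e (Spec.rep t.2) t.1

theorem sat_valToInt (he : IsStrongUnit e) {I : R →+ ℝ} (hI : IsIntegral e I) (t : ℚ × Spec e) :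
    Sat (fun f => 0 < I f) (valToInt e t) ↔ (t.1 : ℝ) < intVal I t.2 := by
  refine (sat_supIntGt he hI _ _).trans ?_
  rw [Spec.D_rep]

/-- The formula `0 < I_μ (f⁺) - I_μ (f⁻)`. -/
noncomputable def intToVal (he : IsStrongUnit e) (f : R) : Formula (ℚ × Spec e) :=
  stieltjesPos e f (he.exists_strictlyBelow f⁺).choose (he.exists_strictlyBelow f⁻).choose

theorem sat_intToVal (he : IsStrongUnit e) {I : R →+ ℝ} (hI : IsIntegral e I) (f : R) :
    Sat (fun t => (t.1 : ℝ) < intVal I t.2) (intToVal he f) ↔ 0 < I f :=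
  hI.sat_stieltjesPos he (he.exists_strictlyBelow f⁺).choose_spec
    (he.exists_strictlyBelow f⁻).choose_spec

theorem sat_subst_valToInt (he : IsStrongUnit e) {I : R →+ ℝ} (hI : IsIntegral e I)
    (φ : Formula (ℚ × Spec e)) :
    Sat (fun f => 0 < I f) (φ.subst (valToInt e)) ↔ Sat (fun t => (t.1 : ℝ) < intVal I t.2) φ := by
  rw [sat_subst, funext fun t => propext (sat_valToInt he hI t)]

theorem sat_subst_intToVal (he : IsStrongUnit e) {I : R →+ ℝ} (hI : IsIntegral e I)
    (φ : Formula R) :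
    Sat (fun t => (t.1 : ℝ) < intVal I t.2) (φ.subst (intToVal he)) ↔ Sat (fun f => 0 < I f) φ := by
  rw [sat_subst, funext fun f => propext (sat_intToVal he hI f)]

/-- The interpretation of valuations in integrals. -/
noncomputable def valInInt (he : IsStrongUnit e) : Interpretation (VAL e) (INT e) where
  map := valToInt e
  sound φ ψ h := entails_INT he fun _ hI hφ => (sat_subst_valToInt he hI ψ).2
    ((hI.isValuation_intVal he).isModel φ ψ h ((sat_subst_valToInt he hI φ).1 hφ))

/-- The interpretation of integrals in valuations. -/
noncomputable def intInVal (he : IsStrongUnit e) : Interpretation (INT e) (VAL e) where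
  map := intToVal (R := R) he
  sound φ ψ h := entails_VAL he fun _ hI hφ => (sat_subst_intToVal (R := R) he hI ψ).2
    (hI.isModel φ ψ h ((sat_subst_intToVal (R := R) he hI φ).1 hφ))

theorem mutuallyInverse (he : IsStrongUnit e) : (valInInt he).MutuallyInverse (intInVal he) :=
  ⟨fun f => equivalent_INT he fun _ hI =>
      (sat_subst_valToInt he hI (intToVal he f)).trans (sat_intToVal he hI f),
    fun t => equivalent_VAL he fun _ hI =>
      (sat_subst_intToVal he hI (valToInt e t)).trans (sat_valToInt he hI t)⟩

end RieszVal

theorem mainTheorem1 {R : Type u} [AddCommGroup R] [Lattice R] [IsOrderedAddMonoid R]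
    [Module ℚ R] [IsOrderedModule ℚ R] (e : R) (he : RieszVal.IsStrongUnit e) :
    ∃ (Φ : RieszVal.Interpretation (RieszVal.VAL e) (RieszVal.INT e))
      (Ψ : RieszVal.Interpretation (RieszVal.INT e) (RieszVal.VAL e)),
      -- `Φ` interprets `p < μ (D a)` as `p < sup_n I (n a⁺ ∧ 1)`
      (∀ (a : R) (p : ℚ),
        (RieszVal.INT e).Equivalent (Φ.map (p, RieszVal.Spec.D e a)) (RieszVal.supIntGt e a p)) ∧
      -- `Ψ` interprets `I f`, for `f ≥ 0`, by the lower and upper Riemann-Stieltjes sums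
      (∀ (f : R) (b : ℚ), 0 ≤ f → RieszVal.StrictlyBelow e f b → ∀ p : ℚ,
        (RieszVal.VAL e).Equivalent (Ψ.translate (RieszVal.intGt e f p))
          (RieszVal.stieltjesGt e f b p) ∧
        (RieszVal.VAL e).Equivalent (Ψ.translate (RieszVal.intLt e f p))
          (RieszVal.stieltjesLt e f b p)) ∧
      -- and `0 < I f`, for arbitrary `f`, as `0 < I (f⁺) - I (f⁻)`
      (∀ (f : R) (b c : ℚ), RieszVal.StrictlyBelow e f⁺ b → RieszVal.StrictlyBelow e f⁻ c →
        (RieszVal.VAL e).Equivalent (Ψ.map f) (RieszVal.stieltjesPos e f b c)) ∧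
      -- the two interpretations are mutually inverse
      Φ.MutuallyInverse Ψ ∧
      -- they induce a homeomorphism of the corresponding locales
      (∃ h : (RieszVal.VAL e).Loc ≃o (RieszVal.INT e).Loc,
        (∀ φ, h ((RieszVal.VAL e).opn φ) = (RieszVal.INT e).opn (Φ.translate φ)) ∧
        (∀ ψ, h.symm ((RieszVal.INT e).opn ψ) = (RieszVal.VAL e).opn (Ψ.translate ψ))) ∧
      -- which are compact and completely regular
      RieszVal.IsCompactCompletelyRegular (RieszVal.VAL e).Loc ∧
      RieszVal.IsCompactCompletelyRegular (RieszVal.INT e).Loc := by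
  refine ⟨RieszVal.valInInt he, RieszVal.intInVal he, fun a p => ?_, fun f b hf hb p => ⟨?_, ?_⟩,
    fun f b c hb hc => ?_, RieszVal.mutuallyInverse he,
    ⟨(RieszVal.mutuallyInverse he).locIso, fun φ => rfl, fun ψ => rfl⟩,
    RieszVal.isCompactCompletelyRegular_VAL he, RieszVal.isCompactCompletelyRegular_INT he⟩
  · exact RieszVal.equivalent_INT he fun I hI =>
      (RieszVal.sat_valToInt he hI _).trans (RieszVal.sat_supIntGt he hI a p).symm
  -- The translation decomposes `f - p e` into positive and negative parts, whereas the target uses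
  -- sums for `f` itself. At each integral both say `p < I f`.
  · refine RieszVal.equivalent_VAL he fun I hI => (RieszVal.sat_intToVal he hI _).trans ?_
    rw [hI.sat_stieltjesGt he hf hb, hI.map_sub_smul_unit, sub_pos]
  · refine RieszVal.equivalent_VAL he fun I hI => (RieszVal.sat_intToVal he hI _).trans ?_
    rw [hI.sat_stieltjesLt he hf hb, map_sub, hI.smul_unit, sub_pos]
  · exact RieszVal.equivalent_VAL he fun I hI =>
      (RieszVal.sat_intToVal he hI f).trans (hI.sat_stieltjesPos he hb hc).symm
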